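/- Consider the isosceles Schwarzschild three-body problem: two equal masses $M>0$ lie in a horizontal plane, symmetric with respect to their midpoint $O$, and a mass $m>0$ moves on the vertical axis through $O$. Let $R>0$ be the distance of the equal masses, $z$ the height of $m$ over $O$, and $P_R,P_z$ the conjugate momenta. For fixed angular momentum $C\in\mathbb R$ the motion in the phase space $\{(R,z,P_R,P_z)\in\mathbb R^4: R>0\}$ is governed by Hamilton's equations of $$H_C=\frac1M\Big(P_R^2+\frac{C^2}{R^2}\Big)+\frac{2M+m}{4Mm}P_z^2-\frac AR-\frac B{R^3}-\frac{4A_1}{\sqrt{R^2+4z^2}}-\frac{16B_1}{(R^2+4z^2)^{3/2}},$$ where $A,A_1,B,B_1>0$. Put $\mu=\frac{2M+m}{m}$ and assume $\mu>1+\frac A{4A_1}$, $\mu>1+\frac B{16B_1}$ and $(\mu-1)^{4/15}\big(\frac{4A_1}{A}\big)^{2/3}\ne\big(\frac{16B_1}{B}\big)^{2/5}$. A point of the phase space is said to lead to triple collision with a non-degenerate triangular limiting configuration if its solution is defined on some $[0,T)$ with $0<T<\infty$ and, as $t\to T^-$, $R\to0$, $z\to0$ and $z/R\to L$ for some real $L\neq0$.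 Let $r=\sqrt{\frac M2R^2+\frac{2Mm}{2M+m}z^2}$, let $\theta\in(-\frac\pi2,\frac\pi2)$ be defined by $\sqrt{\frac M2}\,R=r\cos\theta$ and $\sqrt{\frac{2Mm}{2M+m}}\,z=r\sin\theta$, and put $$v=r^{1/2}(RP_R+zP_z),\qquad u=r^{3/2}\Big(-\sqrt{\tfrac2M}\,P_R\sin\theta+\sqrt{\tfrac{2M+m}{2Mm}}\,P_z\cos\theta\Big),$$ $$W(\theta)=\Big(\frac M2\Big)^{3/2}\Big(\frac B{\cos^3\theta}+\frac{16B_1}{(\cos^2\theta+\mu\sin^2\theta)^{3/2}}\Big),\qquad w=\frac{\cos^{3}\theta}{\sqrt{W(\theta)\cos^3\theta}}\,u .$$ Let $\theta_w\in(0,\frac\pi2)$ be given by $$\cos\theta_w=\sqrt{\frac{\mu}{(\mu-1)+(\mu-1)^{2/5}(16B_1/B)^{2/5}}}$$ (the positive critical point of $W$), and in the variables $(r,v,\theta,w)$ let $E^*_\pm=(0,-\sqrt{2W(\theta_w)},\pm\theta_w,0)$. Then the following hold. 1. For every angular momentum $C$ and every energy $h$, the set of points of the energy level $\{R>0,\ H_C=h\}$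 that lead to triple collision with a non-degenerate triangular limiting configuration has zero (three-dimensional) Lebesgue measure in that energy level, that is, zero three-dimensional Hausdorff measure. 2. For every $C$, a point of the phase space leads to triple collision with a non-degenerate triangular limiting configuration if and only if, in the variables $(r,v,\theta,w)$, its solution on some $[0,T)$, $0<T<\infty$, tends to $E^*_+$ or to $E^*_-$ as $t\to T^-$. 3. The limiting configurations in question are not configurations of homographic solutions: if $L\ne0$ is the limit of $z/R$ along a solution that ends in triple collision, then no homographic solution (of any angular momentum, on any non-empty open time interval) has $|z|/R=|L|$ at any time. Here a homographic solution is one along which the Jacobi vectors $\mathbf r_1=(R\cos\phi,R\sin\phi,0)$, with $\dot\phi=\frac{2C}{MR^2}$, and $\mathbf r_2=(0,0,z)$ have the form $\mathbf r_1(t)=\varphi(t)\Omega(t)\mathbf a_1$ and $\mathbf r_2(t)=\varphi(t)\mathbf a_2$, where $\varphi$ is a nowhere vanishing real function, $\Omega(t)$ is a rotation about the vertical axis, and $\mathbf a_1=(a,b,0)$, $\mathbf a_2=(0,0,c)$ are fixed vectors, not both zero. -/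

import Mathlib

open Filter Topology

noncomputable section

namespace IsoscelesSchwarzschild

/-- The six external parameters: the equal masses `M`, the mass `m` on the axis, and the constants
of the pair potentials `-A/ρ - B/ρ³` (equal masses) and `-2A₁/ρ - 2B₁/ρ³` (`m` with either of the
equal masses), `ρ` being the mutual distance. -/
structure Params where
  M : ℝ
  m : ℝ
  A : ℝ
  A₁ : ℝ
  B : ℝ
  B₁ : ℝ
  M_pos : 0 < M
  m_pos : 0 < m
  A_pos : 0 < A
  A₁_pos : 0 < A₁
  B_pos : 0 < B
  B₁_pos : 0 < B₁

/-- Points `x = (R, z, P_R, P_z)`: `R = x 0` is the distance of the equal masses, `z = x 1` the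
height of `m` over their midpoint, and `P_R = x 2`, `P_z = x 3` are the conjugate momenta. The
phase space is the part `0 < R`. -/
abbrev Phase := EuclideanSpace ℝ (Fin 4)

/-- The potential in cylindrical coordinates. -/
def potential (P : Params) (R z : ℝ) : ℝ :=
  -P.A / R - P.B / R ^ 3 - 4 * P.A₁ / √(R ^ 2 + 4 * z ^ 2)
    - 16 * P.B₁ / √(R ^ 2 + 4 * z ^ 2) ^ 3

/-- The reduced Hamiltonian at angular momentum `C`. -/
def hamiltonian (P : Params) (C : ℝ) (x : Phase) : ℝ :=
  1 / P.M * (x 2 ^ 2 + C ^ 2 / x 0 ^ 2) + (2 * P.M + P.m) / (4 * P.M * P.m) * x 3 ^ 2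
    + potential P (x 0) (x 1)

/-- The energy level `h` of the reduced problem with angular momentum `C`. -/
def energyLevel (P : Params) (C h : ℝ) : Set Phase :=
  {x | 0 < x 0 ∧ hamiltonian P C x = h}

/-- The Hamiltonian vector field `(∂H/∂P_R, ∂H/∂P_z, -∂H/∂R, -∂H/∂z)`. -/
def vectorField (P : Params) (C : ℝ) (x : Phase) : Phase :=
  !₂[2 / P.M * x 2,
     (2 * P.M + P.m) / (2 * P.M * P.m) * x 3,
     2 * C ^ 2 / (P.M * x 0 ^ 3) - P.A / x 0 ^ 2 - 3 * P.B / x 0 ^ 4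
        - 4 * P.A₁ * x 0 / √(x 0 ^ 2 + 4 * x 1 ^ 2) ^ 3
        - 48 * P.B₁ * x 0 / √(x 0 ^ 2 + 4 * x 1 ^ 2) ^ 5,
     -(4 * P.A₁ / √(x 0 ^ 2 + 4 * x 1 ^ 2) ^ 3
        + 48 * P.B₁ / √(x 0 ^ 2 + 4 * x 1 ^ 2) ^ 5) * (4 * x 1)]

/-- `γ` is, on the time set `I`, a solution of the reduced equations of motion free of double and
triple collisions. -/
def IsSolutionOn (P : Params) (C : ℝ) (γ : ℝ → Phase) (I : Set ℝ) : Prop :=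
  ∀ t ∈ I, 0 < γ t 0 ∧ HasDerivWithinAt γ (vectorField P C (γ t)) I t

/-- The solution starting at `x` ends at some time `T > 0` in triple collision, `R → 0` and
`z → 0`, and its configuration has the limiting shape `z / R → L`. -/
def TripleCollisionWithShape (P : Params) (C : ℝ) (x : Phase) (L : ℝ) : Prop :=
  ∃ (T : ℝ) (γ : ℝ → Phase), 0 < T ∧ γ 0 = x ∧ IsSolutionOn P C γ (Set.Ico 0 T) ∧
    Tendsto (fun t => γ t 0) (𝓝[<] T) (𝓝 0) ∧
    Tendsto (fun t => γ t 1) (𝓝[<] T) (𝓝 0) ∧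
    Tendsto (fun t => γ t 1 / γ t 0) (𝓝[<] T) (𝓝 L)

/-- Triple collision with a non-degenerate (isosceles) triangle as limiting configuration: the
limit of `z / R` exists and is neither `0` (three collinear masses) nor `±∞` (coinciding equal
masses). -/
def TriangularTripleCollision (P : Params) (C : ℝ) (x : Phase) : Prop :=
  ∃ L : ℝ, L ≠ 0 ∧ TripleCollisionWithShape P C x L

/-- `μ = (2M + m) / m`. -/
def mu (P : Params) : ℝ := (2 * P.M + P.m) / P.m

/-- The function `W(θ)`. -/
def W (P : Params) (θ : ℝ) : ℝ :=
  √(P.M / 2) ^ 3 * (P.B / Real.cos θ ^ 3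
    + 16 * P.B₁ / √(Real.cos θ ^ 2 + mu P * Real.sin θ ^ 2) ^ 3)

/-- The positive critical point `θ_w` of `W` in `(-π/2, π/2)`. -/
def thetaW (P : Params) : ℝ :=
  Real.arccos √(mu P / ((mu P - 1)
    + (mu P - 1) ^ (2 / 5 : ℝ) * (16 * P.B₁ / P.B) ^ (2 / 5 : ℝ)))

/-- First diagonal entry of the mass matrix `T`. -/
def T₁ (P : Params) : ℝ := P.M / 2

/-- Second diagonal entry of the mass matrix `T`. -/
def T₂ (P : Params) : ℝ := 2 * P.M * P.m / (2 * P.M + P.m)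

/-- `r = √(𝐱ᵗ T 𝐱)` with `𝐱 = (R, z)`. -/
def rCoord (P : Params) (x : Phase) : ℝ := √(T₁ P * x 0 ^ 2 + T₂ P * x 1 ^ 2)

/-- `𝐬 · 𝐩` with `𝐬 = 𝐱 / r` and `𝐩 = (P_R, P_z)`. -/
def sDotP (P : Params) (x : Phase) : ℝ :=
  x 0 / rCoord P x * x 2 + x 1 / rCoord P x * x 3

/-- `v = r^{3/2} (𝐬 · 𝐩)`. -/
def vCoord (P : Params) (x : Phase) : ℝ := rCoord P x ^ (3 / 2 : ℝ) * sDotP P x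

/-- The angle `θ ∈ (-π/2, π/2)` with `𝐬 = T^{-1/2} (cos θ, sin θ)`. -/
def thetaCoord (P : Params) (x : Phase) : ℝ :=
  Real.arcsin (√(T₂ P) * (x 1 / rCoord P x))

/-- The number `u` with `𝐮 = r^{3/2} (T⁻¹ 𝐩 - (𝐬 · 𝐩) 𝐬) = u T^{-1/2} (-sin θ, cos θ)`, that is,
the scalar product of `T^{1/2} 𝐮` and `(-sin θ, cos θ)`. -/
def uCoord (P : Params) (x : Phase) : ℝ :=
  √(T₁ P) * (rCoord P x ^ (3 / 2 : ℝ) * (x 2 / T₁ P - sDotP P x * (x 0 / rCoord P x)))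
      * (-Real.sin (thetaCoord P x))
    + √(T₂ P) * (rCoord P x ^ (3 / 2 : ℝ) * (x 3 / T₂ P - sDotP P x * (x 1 / rCoord P x)))
      * Real.cos (thetaCoord P x)

/-- `w = (cos³ θ / √(U(θ))) u`, where `U(θ) = W(θ) cos³ θ`. -/
def wCoord (P : Params) (x : Phase) : ℝ :=
  Real.cos (thetaCoord P x) ^ 3
    / √(W P (thetaCoord P x) * Real.cos (thetaCoord P x) ^ 3) * uCoord P x

/-- The change of variables `(R, z, P_R, P_z) ↦ (r, v, θ, w)`. -/
def mcGehee (P : Params) (x : Phase) : ℝ × ℝ × ℝ × ℝ :=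
  (rCoord P x, vCoord P x, thetaCoord P x, wCoord P x)

/-- The equilibrium `E*₊` of the triple collision manifold, in the variables `(r, v, θ, w)`. -/
def EstarPlus (P : Params) : ℝ × ℝ × ℝ × ℝ := (0, -√(2 * W P (thetaW P)), thetaW P, 0)

/-- The equilibrium `E*₋` of the triple collision manifold, in the variables `(r, v, θ, w)`. -/
def EstarMinus (P : Params) : ℝ × ℝ × ℝ × ℝ := (0, -√(2 * W P (thetaW P)), -thetaW P, 0)

/-- The orbit of `x` tends, in the variables `(r, v, θ, w)`, to the point `E` of the triple
collision manifold, which it reaches at a finite physical time `T`. -/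
def OrbitTendsTo (P : Params) (C : ℝ) (x : Phase) (E : ℝ × ℝ × ℝ × ℝ) : Prop :=
  ∃ (T : ℝ) (γ : ℝ → Phase), 0 < T ∧ γ 0 = x ∧ IsSolutionOn P C γ (Set.Ico 0 T) ∧
    Tendsto (fun t => mcGehee P (γ t)) (𝓝[<] T) (𝓝 E)

/-- The motion with reduced solution `γ` and angle `ϕ` of the equal masses (so that the Jacobi
vectors are `𝐫₁ = (R cos ϕ, R sin ϕ, 0)` and `𝐫₂ = (0, 0, z)`) is homographic on `I`:
`𝐫₁(t) = φ(t) Ω(t) 𝐚₁` and `𝐫₂(t) = φ(t) 𝐚₂`, where `φ` has no zero, `Ω(t)` is the rotation by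
`ψ(t)` about the vertical axis and `𝐚₁ = (a, b, 0)`, `𝐚₂ = (0, 0, c)` do not both vanish. -/
def IsHomographicOn (P : Params) (C : ℝ) (γ : ℝ → Phase) (ϕ : ℝ → ℝ) (I : Set ℝ) : Prop :=
  IsSolutionOn P C γ I ∧
  (∀ t ∈ I, HasDerivWithinAt ϕ (2 * C / (P.M * γ t 0 ^ 2)) I t) ∧
  ∃ (φ ψ : ℝ → ℝ) (a b c : ℝ), (a, b, c) ≠ (0, 0, 0) ∧ ∀ t ∈ I, φ t ≠ 0 ∧
    γ t 0 * Real.cos (ϕ t) = φ t * (a * Real.cos (ψ t) - b * Real.sin (ψ t)) ∧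
    γ t 0 * Real.sin (ϕ t) = φ t * (a * Real.sin (ψ t) + b * Real.cos (ψ t)) ∧
    γ t 1 = φ t * c

end IsoscelesSchwarzschild

end

open IsoscelesSchwarzschild

/-! Near collision, use q = z/R, σ = dz/dR and R as coordinates and s = -log R as time. On an energy
level the motion becomes q' = q - σ, σ' = G(q, σ, R), R' = -R. Here G (`slopeField`) is still C¹ at
R = 0, since the Newtonian, centrifugal and energy terms carry positive powers of R relative to the
Schwarzschild terms.

L'Hôpital's rule for z/R (form 0/0) and for P_z/P_R (form ∞/∞) shows that an orbit with z/R → L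
tends to (L, L, 0), and that L ≠ 0 solves the equation of the critical points ±θ_w of W
(`shapeRho_limit`). With the energy integral this yields the limits of v and w (`tendsto_mcGehee`).
Conversely, r and θ alone determine R and z/R.

For the measure, (L, L, 0) is a saddle with a single unstable direction
(`exists_fderiv_slopeField`). Instead of an invariant manifold, a quadratic form is evaluated on the
difference of two orbits. It is nondecreasing near the saddle and tends to 0, hence is nonpositive
at the start (`exists_cone`). The initial points thus lie in cones about a plane, so their dimension
is at most 2 (`dimH_le_two_of_cone`). The backward flow is Lipschitz on compact sets and carries the
bound to the whole collision set, a countable union of such pieces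
(`dimH_tripleCollisionWithShape_le`); dimension below 3 makes it null.

A homographic solution of shape L must balance the Newtonian and centrifugal terms separately. The
genericity condition then forces R to be constant, hence an equilibrium, and an equilibrium has z =
0 (`homographic_shape_ne`). -/

namespace IsoscelesSchwarzschild

/-! ### One-sided calculus: L'Hôpital's rule and change of time. -/

section Calculus

open Set

theorem monotoneOn_Ioo_of_hasDerivAt_nonneg {f f' : ℝ → ℝ} {a b : ℝ}
    (hf : ∀ t ∈ Ioo a b, HasDerivAt f (f' t) t) (hf' : ∀ t ∈ Ioo a b, 0 ≤ f' t) :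
    MonotoneOn f (Ioo a b) := by
  refine monotoneOn_of_deriv_nonneg (convex_Ioo a b)
    (fun t ht => (hf t ht).continuousAt.continuousWithinAt) ?_ ?_
  · rw [interior_Ioo]
    exact fun t ht => (hf t ht).differentiableAt.differentiableWithinAt
  · rw [interior_Ioo]
    intro t ht
    rw [(hf t ht).deriv]
    exact hf' t ht

theorem eventually_nhdsLT_iff_Ioo {p : ℝ → Prop} {b : ℝ} :
    (∀ᶠ t in 𝓝[<] b, p t) ↔ ∃ a < b, ∀ t ∈ Ioo a b, p t :=
  mem_nhdsLT_iff_exists_Ioo_subset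

/-- As c·g - f is nondecreasing near b, f exceeds c·g by at most a constant, which ε·g absorbs
because g → ∞. -/
theorem eventually_le_mul_of_deriv_le_mul {f g f' g' : ℝ → ℝ} {b c : ℝ}
    (hf : ∀ᶠ t in 𝓝[<] b, HasDerivAt f (f' t) t) (hg : ∀ᶠ t in 𝓝[<] b, HasDerivAt g (g' t) t)
    (hle : ∀ᶠ t in 𝓝[<] b, f' t ≤ c * g' t) (hgt : Tendsto g (𝓝[<] b) atTop)
    {ε : ℝ} (hε : 0 < ε) : ∀ᶠ t in 𝓝[<] b, f t ≤ (c + ε) * g t := by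
  obtain ⟨a, hab, ha⟩ := eventually_nhdsLT_iff_Ioo.1 (hf.and (hg.and hle))
  have hmono : MonotoneOn (fun t => c * g t - f t) (Ioo a b) :=
    monotoneOn_Ioo_of_hasDerivAt_nonneg (f' := fun t => c * g' t - f' t)
      (fun t ht => ((ha t ht).2.1.const_mul c).sub (ha t ht).1)
      (fun t ht => sub_nonneg.2 (ha t ht).2.2)
  obtain ⟨t₀, ht₀⟩ : (Ioo a b).Nonempty := nonempty_Ioo.2 hab
  have h1 : ∀ᶠ t in 𝓝[<] b, t ∈ Ioo t₀ b := Ioo_mem_nhdsLT ht₀.2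
  filter_upwards [h1, hgt.eventually_ge_atTop ((f t₀ - c * g t₀) / ε)] with t ht hgt
  have h2 := hmono ht₀ ⟨ht₀.1.trans ht.1, ht.2⟩ ht.1.le
  rw [div_le_iff₀ hε] at hgt
  simp only at h2
  linarith

/-- L'Hôpital's rule for the indeterminate form `∞ / ∞`, for a left-sided limit. -/
theorem lhopital_atTop_nhdsLT {f g f' g' : ℝ → ℝ} {b l : ℝ}
    (hf : ∀ᶠ t in 𝓝[<] b, HasDerivAt f (f' t) t) (hg : ∀ᶠ t in 𝓝[<] b, HasDerivAt g (g' t) t)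
    (hg' : ∀ᶠ t in 𝓝[<] b, 0 < g' t) (hgt : Tendsto g (𝓝[<] b) atTop)
    (hdiv : Tendsto (fun t => f' t / g' t) (𝓝[<] b) (𝓝 l)) :
    Tendsto (fun t => f t / g t) (𝓝[<] b) (𝓝 l) := by
  refine tendsto_order.2 ⟨fun c hc => ?_, fun c hc => ?_⟩
  -- The slope (3l + c)/4 lies strictly between c and l; giving up ε = (l - c)/4 still leaves (l +
  -- c)/2 > c.
  · have h1 : ∀ᶠ t in 𝓝[<] b, -f' t ≤ -((l + (c + l) / 2) / 2) * g' t := by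
      filter_upwards [hg', hdiv.eventually_const_lt (show (l + (c + l) / 2) / 2 < l by linarith)]
        with t ht h
      rw [lt_div_iff₀ ht] at h
      linarith
    filter_upwards [eventually_le_mul_of_deriv_le_mul (hf.mono fun t ht => ht.neg) hg h1 hgt
      (show 0 < (l - c) / 4 by linarith), hgt.eventually_gt_atTop 0] with t ht hpos
    rw [lt_div_iff₀ hpos]
    simp only [Pi.neg_apply] at ht
    nlinarith [mul_pos (sub_pos.2 hc) hpos]
  · have h1 : ∀ᶠ t in 𝓝[<] b, f' t ≤ ((l + c) / 2) * g' t := by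
      filter_upwards [hg', hdiv.eventually_lt_const (show l < (l + c) / 2 by linarith)] with t ht h
      rw [div_lt_iff₀ ht] at h
      exact h.le
    filter_upwards [eventually_le_mul_of_deriv_le_mul hf hg h1 hgt
      (show 0 < (c - l) / 4 by linarith), hgt.eventually_gt_atTop 0] with t ht hpos
    rw [div_lt_iff₀ hpos]
    nlinarith [mul_pos (sub_pos.2 hc) hpos]

/-- A function that increases to `∞` on `(a, b)` can be used as a time parameter. -/
theorem exists_time_change {f f' : ℝ → ℝ} {a b c : ℝ}
    (hf : ∀ t ∈ Ioo a b, HasDerivAt f (f' t) t) (hf' : ∀ t ∈ Ioo a b, 0 < f' t)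
    (hft : Tendsto f (𝓝[<] b) atTop) (hc : c ∈ Ioo a b) :
    ∃ τ : ℝ → ℝ, τ 0 = c ∧ (∀ s, 0 ≤ s → τ s ∈ Ico c b ∧ f (τ s) = f c + s ∧
      HasDerivAt τ (f' (τ s))⁻¹ s) ∧ Tendsto τ atTop (𝓝[<] b) := by
  have hcont : ContinuousOn f (Ioo a b) := fun t ht => (hf t ht).continuousAt.continuousWithinAt
  have hmono : StrictMonoOn f (Ioo a b) := by
    refine strictMonoOn_of_deriv_pos (convex_Ioo a b) hcont ?_
    rw [interior_Ioo]
    intro t ht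
    rw [(hf t ht).deriv]
    exact hf' t ht
  -- Starting the inverse function below c makes it two-sidedly differentiable at `f c`, that is, at
  -- s = 0.
  obtain ⟨d, had, hdc⟩ := exists_between hc.1
  have hd : d ∈ Ioo a b := ⟨had, hdc.trans hc.2⟩
  have hex : ∀ y, f d < y → ∃ t ∈ Ioo d b, f t = y := by
    intro y hy
    obtain ⟨e, hye, he⟩ := ((hft.eventually_gt_atTop y).and
      (Ioo_mem_nhdsLT hd.2 : ∀ᶠ t in 𝓝[<] b, t ∈ Ioo d b)).exists
    obtain ⟨t, ht, rfl⟩ := intermediate_value_Ioo he.1.le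
      (hcont.mono fun t ht => ⟨had.trans_le ht.1, ht.2.trans_lt he.2⟩) ⟨hy, hye⟩
    exact ⟨t, ⟨ht.1, ht.2.trans he.2⟩, rfl⟩
  choose! g hgm hg using hex
  have hsub : ∀ t ∈ Ioo d b, t ∈ Ioo a b := fun t ht => ⟨had.trans ht.1, ht.2⟩
  have hgmono : StrictMonoOn g (Ioi (f d)) := by
    intro y hy z hz hyz
    by_contra h
    have := hmono.monotoneOn (hsub _ (hgm z hz)) (hsub _ (hgm y hy)) (not_lt.1 h)
    rw [hg y hy, hg z hz] at this
    exact absurd hyz this.not_gt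
  have hgf : ∀ t ∈ Ioo d b, g (f t) = t := by
    intro t ht
    have h1 : f d < f t := hmono hd (hsub t ht) ht.1
    exact hmono.injOn (hsub _ (hgm _ h1)) (hsub t ht) (hg _ h1)
  have himg : g '' Ioi (f d) = Ioo d b := by
    ext t
    constructor
    · rintro ⟨y, hy, rfl⟩
      exact hgm y hy
    · intro ht
      exact ⟨f t, hmono hd (hsub t ht) ht.1, hgf t ht⟩
  have hgder : ∀ y ∈ Ioi (f d), HasDerivAt g (f' (g y))⁻¹ y := by
    intro y hy
    have hcg : ContinuousAt g y := by
      refine hgmono.continuousAt_of_image_mem_nhds (Ioi_mem_nhds hy) ?_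
      rw [himg]
      exact Ioo_mem_nhds (hgm y hy).1 (hgm y hy).2
    refine HasDerivAt.of_local_left_inverse hcg (hf _ (hsub _ (hgm y hy)))
      (hf' _ (hsub _ (hgm y hy))).ne' ?_
    filter_upwards [Ioi_mem_nhds hy] with z hz using hg z hz
  have hdc' : f d < f c := hmono hd hc hdc
  have hgc : g (f c) = c := hgf c ⟨hdc, hc.2⟩
  refine ⟨fun s => g (f c + s), by simpa using hgc, fun s hs => ⟨⟨?_, ?_⟩, ?_, ?_⟩, ?_⟩
  · have := hgmono.monotoneOn hdc' (show f d < f c + s by linarith) (show f c ≤ f c + s by linarith)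
    rwa [hgc] at this
  · exact (hgm _ (by linarith)).2
  · exact hg _ (by linarith)
  · exact (hgder (f c + s) (show f d < f c + s by linarith)).comp_const_add (f c) s
  · rw [tendsto_nhdsWithin_iff]
    constructor
    · refine tendsto_order.2 ⟨fun e he => ?_, fun e he => ?_⟩
      · obtain ⟨e', he', heb⟩ := exists_between (max_lt he hd.2)
        have h1 : e' ∈ Ioo d b := ⟨(le_max_right _ _).trans_lt he', heb⟩
        filter_upwards [eventually_gt_atTop (f e' - f c), eventually_ge_atTop 0] with s hs hs0
        refine (le_max_left e d).trans_lt (he'.trans ?_)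
        have := hgmono (hmono hd (hsub _ h1) h1.1) (show f d < f c + s by linarith)
          (show f e' < f c + s by linarith)
        rwa [hgf _ h1] at this
      · filter_upwards [eventually_ge_atTop 0] with s hs
        exact (hgm _ (show f d < f c + s by linarith)).2.trans he
    · filter_upwards [eventually_ge_atTop 0] with s hs
      exact (hgm _ (show f d < f c + s by linarith)).2

end Calculus

/-! ### Hausdorff dimension under Lipschitz parametrization. -/

section Dimension

open scoped NNReal ENNReal

/-- A set that is Lipschitz parametrized by its image in `Y` has at most the dimension of the
image. -/
theorem dimH_le_dimH_image_of_dist_le {X Y : Type*} [MetricSpace X] [MetricSpace Y] {s : Set X}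
    {f : X → Y} {K : ℝ} (h : ∀ x ∈ s, ∀ y ∈ s, dist x y ≤ K * dist (f x) (f y)) :
    dimH s ≤ dimH (f '' s) := by
  have h1 : AntilipschitzWith K.toNNReal (fun x : s => f x) := by
    refine AntilipschitzWith.of_le_mul_dist fun x y => ?_
    refine (h x x.2 y y.2).trans ?_
    gcongr
    exact Real.le_coe_toNNReal K
  have h2 := h1.le_dimH_image Set.univ
  rw [← (isometry_subtype_coe (s := s)).dimH_image] at h2
  simpa [Set.image_univ, ← Set.image_eq_range] using h2

theorem dimH_plane_le (s : Set (ℝ × ℝ)) : dimH s ≤ 2 := by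
  refine (dimH_mono (Set.subset_univ s)).trans ?_
  rw [Real.dimH_univ_eq_finrank]
  simp

end Dimension

/-! ### The equations of motion in terms of q = z/R and R. -/

section Scaling

open Set

theorem T₁_pos (P : Params) : 0 < T₁ P := by
  have := P.M_pos
  unfold T₁; positivity

theorem T₂_pos (P : Params) : 0 < T₂ P := by
  have := P.M_pos
  have := P.m_pos
  unfold T₂; positivity

theorem mu_mul_T₂ (P : Params) : mu P * T₂ P = 4 * T₁ P := by
  have := P.M_pos
  have := P.m_pos
  unfold mu T₂ T₁; field_simp; ring

/-- The distance of `m` from the equal masses, relative to half their mutual distance, as a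
function of `q = z / R`. -/
noncomputable def shapeRho (q : ℝ) : ℝ := √(1 + 4 * q ^ 2)

theorem shapeRho_pos (q : ℝ) : 0 < shapeRho q := Real.sqrt_pos.2 (by positivity)

theorem shapeRho_sq (q : ℝ) : shapeRho q ^ 2 = 1 + 4 * q ^ 2 := Real.sq_sqrt (by positivity)

theorem contDiff_shapeRho {n : WithTop ℕ∞} : ContDiff ℝ n shapeRho :=
  ContDiff.sqrt (by fun_prop) fun q => by positivity

@[fun_prop]
theorem continuous_shapeRho : Continuous shapeRho := contDiff_shapeRho (n := 1) |>.continuous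

theorem hasDerivAt_shapeRho (q : ℝ) : HasDerivAt shapeRho (4 * q / shapeRho q) q := by
  have h : HasDerivAt (fun q : ℝ => 1 + 4 * q ^ 2) (8 * q) q := by
    have := (((hasDerivAt_id q).pow 2).const_mul 4).const_add 1
    refine this.congr_deriv ?_
    simp; ring
  refine (h.sqrt (by positivity)).congr_deriv ?_
  rw [shapeRho]
  have : 0 < √(1 + 4 * q ^ 2) := Real.sqrt_pos.2 (by positivity)
  field_simp
  ring

theorem sqrt_sq_add_four_mul_sq {R : ℝ} (hR : 0 < R) (z : ℝ) :
    √(R ^ 2 + 4 * z ^ 2) = R * shapeRho (z / R) := by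
  rw [shapeRho, show R ^ 2 + 4 * z ^ 2 = R ^ 2 * (1 + 4 * (z / R) ^ 2) by field_simp,
    Real.sqrt_mul (by positivity), Real.sqrt_sq hR.le]

/-- `R⁴` times the radial force, as a function of `q = z / R` and `R`. -/
noncomputable def force₁ (P : Params) (C q R : ℝ) : ℝ :=
  2 * C ^ 2 / P.M * R - P.A * R ^ 2 - 3 * P.B - 4 * P.A₁ * R ^ 2 / shapeRho q ^ 3
    - 48 * P.B₁ / shapeRho q ^ 5

/-- `R⁴` times the axial force, as a function of `q = z / R` and `R`. -/
noncomputable def force₂ (P : Params) (q R : ℝ) : ℝ :=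
  -(4 * P.A₁ * R ^ 2 / shapeRho q ^ 3 + 48 * P.B₁ / shapeRho q ^ 5) * (4 * q)

/-- `R³` times the kinetic energy of the motion in `R` and `z` on the energy level `h`. -/
noncomputable def kinetic (P : Params) (C h q R : ℝ) : ℝ :=
  P.B + 16 * P.B₁ / shapeRho q ^ 3 + R ^ 2 * (P.A + 4 * P.A₁ / shapeRho q) - R * C ^ 2 / P.M
    + h * R ^ 3

theorem vectorField_zero (P : Params) (C : ℝ) (x : Phase) :
    vectorField P C x 0 = x 2 / T₁ P := by
  have := P.M_pos
  simp only [vectorField, T₁]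
  change 2 / P.M * x 2 = _
  field_simp

theorem vectorField_one (P : Params) (C : ℝ) (x : Phase) :
    vectorField P C x 1 = x 3 / T₂ P := by
  have := P.M_pos
  have := P.m_pos
  simp only [vectorField, T₂]
  change (2 * P.M + P.m) / (2 * P.M * P.m) * x 3 = _
  field_simp

/-- By homogeneity, R⁴ times the force depends on q and R only and extends continuously to R = 0,
where just the B and B₁ terms survive. -/
theorem vectorField_two (P : Params) (C : ℝ) {x : Phase} (hx : 0 < x 0) :
    vectorField P C x 2 = force₁ P C (x 1 / x 0) (x 0) / x 0 ^ 4 := by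
  have := P.M_pos
  simp only [vectorField, force₁]
  change 2 * C ^ 2 / (P.M * x 0 ^ 3) - P.A / x 0 ^ 2 - 3 * P.B / x 0 ^ 4
        - 4 * P.A₁ * x 0 / √(x 0 ^ 2 + 4 * x 1 ^ 2) ^ 3
        - 48 * P.B₁ * x 0 / √(x 0 ^ 2 + 4 * x 1 ^ 2) ^ 5 = _
  rw [sqrt_sq_add_four_mul_sq hx]
  have := shapeRho_pos (x 1 / x 0)
  generalize shapeRho (x 1 / x 0) = ρ at *
  field_simp

theorem vectorField_three (P : Params) (C : ℝ) {x : Phase} (hx : 0 < x 0) :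
    vectorField P C x 3 = force₂ P (x 1 / x 0) (x 0) / x 0 ^ 4 := by
  simp only [vectorField, force₂]
  change -(4 * P.A₁ / √(x 0 ^ 2 + 4 * x 1 ^ 2) ^ 3
        + 48 * P.B₁ / √(x 0 ^ 2 + 4 * x 1 ^ 2) ^ 5) * (4 * x 1) = _
  rw [sqrt_sq_add_four_mul_sq hx]
  have := shapeRho_pos (x 1 / x 0)
  generalize shapeRho (x 1 / x 0) = ρ at *
  field_simp

theorem hamiltonian_eq (P : Params) (C : ℝ) {x : Phase} (hx : 0 < x 0) :
    hamiltonian P C x = x 2 ^ 2 / (2 * T₁ P) + x 3 ^ 2 / (2 * T₂ P)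
      - kinetic P C 0 (x 1 / x 0) (x 0) / x 0 ^ 3 := by
  have := P.M_pos
  have := P.m_pos
  simp only [hamiltonian, potential, kinetic, T₁, T₂]
  rw [sqrt_sq_add_four_mul_sq hx]
  have := shapeRho_pos (x 1 / x 0)
  generalize shapeRho (x 1 / x 0) = ρ at *
  field_simp
  ring

theorem kinetic_eq_of_hamiltonian_eq {P : Params} {C h : ℝ} {x : Phase} (hx : 0 < x 0)
    (hh : hamiltonian P C x = h) :
    kinetic P C h (x 1 / x 0) (x 0) =
      x 0 ^ 3 * (x 2 ^ 2 / (2 * T₁ P) + x 3 ^ 2 / (2 * T₂ P)) := by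
  have h1 := hamiltonian_eq P C hx
  rw [hh] at h1
  have h2 : kinetic P C h (x 1 / x 0) (x 0) =
      kinetic P C 0 (x 1 / x 0) (x 0) + h * x 0 ^ 3 := by simp [kinetic]
  have : 0 < x 0 ^ 3 := by positivity
  rw [h2, h1]
  field_simp
  ring

theorem continuous_force₁ (P : Params) (C : ℝ) :
    Continuous fun y : ℝ × ℝ => force₁ P C y.1 y.2 := by
  unfold force₁
  have := fun q => (shapeRho_pos q).ne'
  fun_prop (disch := intro x; exact pow_ne_zero _ (this _))

theorem continuous_force₂ (P : Params) :
    Continuous fun y : ℝ × ℝ => force₂ P y.1 y.2 := by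
  unfold force₂
  have := fun q => (shapeRho_pos q).ne'
  fun_prop (disch := intro x; exact pow_ne_zero _ (this _))

theorem continuous_kinetic (P : Params) (C h : ℝ) :
    Continuous fun y : ℝ × ℝ => kinetic P C h y.1 y.2 := by
  unfold kinetic
  have := fun q => (shapeRho_pos q).ne'
  fun_prop (disch := intro x; first | exact pow_ne_zero _ (this _) | exact this _)

theorem force₁_zero_neg (P : Params) (C q : ℝ) : force₁ P C q 0 < 0 := by
  have := P.B_pos
  have := P.B₁_pos
  have := shapeRho_pos q
  have h : force₁ P C q 0 = -(3 * P.B + 48 * P.B₁ / shapeRho q ^ 5) := by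
    unfold force₁; ring
  rw [h]
  exact neg_lt_zero.2 (by positivity)

theorem kinetic_zero (P : Params) (C h q : ℝ) :
    kinetic P C h q 0 = P.B + 16 * P.B₁ / shapeRho q ^ 3 := by
  unfold kinetic; ring

theorem kinetic_zero_pos (P : Params) (C h q : ℝ) : 0 < kinetic P C h q 0 := by
  have := P.B_pos
  have := P.B₁_pos
  have := shapeRho_pos q
  rw [kinetic_zero]
  positivity

end Scaling

/-! ### Components of a solution and conservation of energy. -/

section Solutions

open Set

theorem hasDerivWithinAt_apply {γ : ℝ → Phase} {γ' : Phase} {s : Set ℝ} {t : ℝ}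
    (h : HasDerivWithinAt γ γ' s t) (i : Fin 4) :
    HasDerivWithinAt (fun t => γ t i) (γ' i) s t :=
  (EuclideanSpace.proj (𝕜 := ℝ) i).hasFDerivAt.comp_hasDerivWithinAt t h

theorem hasDerivAt_apply {γ : ℝ → Phase} {γ' : Phase} {t : ℝ}
    (h : HasDerivAt γ γ' t) (i : Fin 4) : HasDerivAt (fun t => γ t i) (γ' i) t :=
  (EuclideanSpace.proj (𝕜 := ℝ) i).hasFDerivAt.comp_hasDerivAt t h

variable {P : Params} {C : ℝ} {γ : ℝ → Phase} {I : Set ℝ} {t T : ℝ}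

theorem IsSolutionOn.hasDerivAt (h : IsSolutionOn P C γ I) (ht : I ∈ 𝓝 t) :
    HasDerivAt γ (vectorField P C (γ t)) t :=
  (h t (mem_of_mem_nhds ht)).2.hasDerivAt ht

theorem IsSolutionOn.hasDerivAt_zero (h : IsSolutionOn P C γ I) (ht : I ∈ 𝓝 t) :
    HasDerivAt (fun t => γ t 0) (γ t 2 / T₁ P) t := by
  rw [← vectorField_zero P C]
  exact hasDerivAt_apply (h.hasDerivAt ht) 0

theorem IsSolutionOn.hasDerivAt_one (h : IsSolutionOn P C γ I) (ht : I ∈ 𝓝 t) :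
    HasDerivAt (fun t => γ t 1) (γ t 3 / T₂ P) t := by
  rw [← vectorField_one P C]
  exact hasDerivAt_apply (h.hasDerivAt ht) 1

theorem IsSolutionOn.hasDerivAt_two (h : IsSolutionOn P C γ I) (ht : I ∈ 𝓝 t) :
    HasDerivAt (fun t => γ t 2) (force₁ P C (γ t 1 / γ t 0) (γ t 0) / γ t 0 ^ 4) t := by
  rw [← vectorField_two P C (h t (mem_of_mem_nhds ht)).1]
  exact hasDerivAt_apply (h.hasDerivAt ht) 2

theorem IsSolutionOn.hasDerivAt_three (h : IsSolutionOn P C γ I) (ht : I ∈ 𝓝 t) :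
    HasDerivAt (fun t => γ t 3) (force₂ P (γ t 1 / γ t 0) (γ t 0) / γ t 0 ^ 4) t := by
  rw [← vectorField_three P C (h t (mem_of_mem_nhds ht)).1]
  exact hasDerivAt_apply (h.hasDerivAt ht) 3

/-- Conservation of energy. -/
theorem IsSolutionOn.hamiltonian_eq (h : IsSolutionOn P C γ (Ico 0 T)) (ht : t ∈ Ico 0 T) :
    hamiltonian P C (γ t) = hamiltonian P C (γ 0) := by
  have hM := P.M_pos
  have hm := P.m_pos
  have key : ∀ s ∈ Ico 0 T, HasDerivWithinAt (fun s => hamiltonian P C (γ s)) 0 (Ico 0 T) s := by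
    intro s hs
    obtain ⟨hR, hγ⟩ := h s hs
    have h0 := hasDerivWithinAt_apply hγ 0
    have h1 := hasDerivWithinAt_apply hγ 1
    have h2 := hasDerivWithinAt_apply hγ 2
    have h3 := hasDerivWithinAt_apply hγ 3
    have hD : 0 < γ s 0 ^ 2 + 4 * γ s 1 ^ 2 := by positivity
    have hsq := ((h0.pow 2).add ((h1.pow 2).const_mul 4)).sqrt hD.ne'
    have hsD := Real.sqrt_pos.2 hD
    have hH := ((((h2.pow 2).add ((hasDerivWithinAt_const s _ (C ^ 2)).div (h0.pow 2)
        (pow_pos hR 2).ne')).const_mul (1 / P.M)).add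
      ((h3.pow 2).const_mul ((2 * P.M + P.m) / (4 * P.M * P.m)))).add
      (((((hasDerivWithinAt_const s _ (-P.A)).div h0 hR.ne').sub
        ((hasDerivWithinAt_const s _ P.B).div (h0.pow 3) (pow_pos hR 3).ne')).sub
        ((hasDerivWithinAt_const s _ (4 * P.A₁)).div hsq hsD.ne')).sub
        ((hasDerivWithinAt_const s _ (16 * P.B₁)).div (hsq.pow 3) (pow_pos hsD 3).ne'))
    refine hH.congr_deriv ?_
    have e2 : vectorField P C (γ s) 2 = 2 * C ^ 2 / (P.M * γ s 0 ^ 3) - P.A / γ s 0 ^ 2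
        - 3 * P.B / γ s 0 ^ 4 - 4 * P.A₁ * γ s 0 / √(γ s 0 ^ 2 + 4 * γ s 1 ^ 2) ^ 3
        - 48 * P.B₁ * γ s 0 / √(γ s 0 ^ 2 + 4 * γ s 1 ^ 2) ^ 5 := rfl
    have e3 : vectorField P C (γ s) 3 = -(4 * P.A₁ / √(γ s 0 ^ 2 + 4 * γ s 1 ^ 2) ^ 3
        + 48 * P.B₁ / √(γ s 0 ^ 2 + 4 * γ s 1 ^ 2) ^ 5) * (4 * γ s 1) := rfl
    have e0 : vectorField P C (γ s) 0 = 2 / P.M * γ s 2 := rfl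
    have e1 : vectorField P C (γ s) 1 = (2 * P.M + P.m) / (2 * P.M * P.m) * γ s 3 := rfl
    rw [e0, e1, e2, e3]
    simp only [Pi.add_apply, Pi.pow_apply]
    generalize √(γ s 0 ^ 2 + 4 * γ s 1 ^ 2) = D at hsD
    push_cast
    field_simp
    ring
  -- Right derivatives suffice, which suits the endpoint 0, where the solution is only one-sidedly
  -- differentiable.
  refine constant_of_has_deriv_right_zero (a := 0) (b := t)
    (f := fun s => hamiltonian P C (γ s)) ?_ ?_ t ⟨ht.1, le_rfl⟩
  · intro s hs
    exact ((key s ⟨hs.1, hs.2.trans_lt ht.2⟩).continuousWithinAt).mono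
      fun r hr => ⟨hr.1, hr.2.trans_lt ht.2⟩
  · intro s hs
    refine (key s ⟨hs.1, hs.2.trans ht.2⟩).mono_of_mem_nhdsWithin ?_
    filter_upwards [self_mem_nhdsWithin,
      mem_nhdsWithin_of_mem_nhds (Iio_mem_nhds (hs.2.trans ht.2))] with r hr hr'
    exact ⟨hs.1.trans hr, hr'⟩

end Solutions

/-! ### Asymptotics at triple collision. -/

section Asymptotics

open Set

variable {P : Params} {C L : ℝ} {γ : ℝ → Phase} {T : ℝ}

theorem eventually_Ico_mem_nhds (hT : 0 < T) : ∀ᶠ t in 𝓝[<] T, Ico 0 T ∈ 𝓝 t := by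
  filter_upwards [Ioo_mem_nhdsLT hT] with t ht using Ico_mem_nhds ht.1 ht.2

theorem eventually_radius_pos (hT : 0 < T) (h : IsSolutionOn P C γ (Ico 0 T)) :
    ∀ᶠ t in 𝓝[<] T, 0 < γ t 0 := by
  filter_upwards [eventually_Ico_mem_nhds hT] with t ht using (h t (mem_of_mem_nhds ht)).1

theorem tendsto_uncurried {F : ℝ → ℝ → ℝ} (hF : Continuous fun y : ℝ × ℝ => F y.1 y.2)
    {ι : Type*} {l : Filter ι} {f g : ι → ℝ} {a b : ℝ} (hf : Tendsto f l (𝓝 a))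
    (hg : Tendsto g l (𝓝 b)) : Tendsto (fun t => F (f t) (g t)) l (𝓝 (F a b)) := by
  have h1 := hF.tendsto (a, b)
  have h2 := hf.prodMk_nhds hg
  exact h1.comp h2

theorem tendsto_force₁ (C : ℝ) (hR : Tendsto (fun t => γ t 0) (𝓝[<] T) (𝓝 0))
    (hq : Tendsto (fun t => γ t 1 / γ t 0) (𝓝[<] T) (𝓝 L)) :
    Tendsto (fun t => force₁ P C (γ t 1 / γ t 0) (γ t 0)) (𝓝[<] T) (𝓝 (force₁ P C L 0)) :=
  tendsto_uncurried (continuous_force₁ P C) hq hR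

theorem tendsto_force₂ (hR : Tendsto (fun t => γ t 0) (𝓝[<] T) (𝓝 0))
    (hq : Tendsto (fun t => γ t 1 / γ t 0) (𝓝[<] T) (𝓝 L)) :
    Tendsto (fun t => force₂ P (γ t 1 / γ t 0) (γ t 0)) (𝓝[<] T) (𝓝 (force₂ P L 0)) :=
  tendsto_uncurried (continuous_force₂ P) hq hR

/-- The radial force is negative near collision, so P_R decreases. If it never became negative, R
would be nondecreasing and could not tend to 0. -/
theorem eventually_momentum_neg (hT : 0 < T) (h : IsSolutionOn P C γ (Ico 0 T))
    (hR : Tendsto (fun t => γ t 0) (𝓝[<] T) (𝓝 0))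
    (hq : Tendsto (fun t => γ t 1 / γ t 0) (𝓝[<] T) (𝓝 L)) :
    ∀ᶠ t in 𝓝[<] T, γ t 2 < 0 := by
  obtain ⟨a, haT, ha⟩ := eventually_nhdsLT_iff_Ioo.1 ((eventually_Ico_mem_nhds hT).and
    ((tendsto_force₁ (P := P) C hR hq).eventually_lt_const (force₁_zero_neg P C L)))
  have hpos : ∀ t ∈ Ioo a T, 0 < γ t 0 := fun t ht => (h t (mem_of_mem_nhds (ha t ht).1)).1
  have hanti : MonotoneOn (fun t => -γ t 2) (Ioo a T) :=
    monotoneOn_Ioo_of_hasDerivAt_nonneg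
      (fun t ht => (h.hasDerivAt_two (ha t ht).1).neg)
      (fun t ht => neg_nonneg.2 (div_nonpos_of_nonpos_of_nonneg (ha t ht).2.le
        (pow_nonneg (hpos t ht).le 4)))
  by_cases hex : ∃ t₀ ∈ Ioo a T, γ t₀ 2 < 0
  · obtain ⟨t₀, ht₀, hneg⟩ := hex
    filter_upwards [Ioo_mem_nhdsLT ht₀.2] with t ht
    have := hanti ht₀ ⟨ht₀.1.trans ht.1, ht.2⟩ ht.1.le
    simp only at this
    linarith
  · push Not at hex
    exfalso
    have hmono : MonotoneOn (fun t => γ t 0) (Ioo a T) :=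
      monotoneOn_Ioo_of_hasDerivAt_nonneg (fun t ht => h.hasDerivAt_zero (ha t ht).1)
        (fun t ht => div_nonneg (hex t ht) (T₁_pos P).le)
    obtain ⟨t₀, ht₀⟩ : (Ioo a T).Nonempty := nonempty_Ioo.2 haT
    obtain ⟨t, h1, h2⟩ := ((hR.eventually_lt_const (hpos t₀ ht₀)).and
      (Ioo_mem_nhdsLT ht₀.2 : ∀ᶠ t in 𝓝[<] T, t ∈ Ioo t₀ T)).exists
    exact absurd (hmono ht₀ ⟨ht₀.1.trans h2.1, h2.2⟩ h2.1.le) h1.not_ge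

/-- The radial force is at most c/R⁴ with c < 0. Multiplying by P_R < 0 and integrating bounds P_R²
below by a positive multiple of R⁻³ plus a constant. -/
theorem tendsto_momentum_atTop (hT : 0 < T) (h : IsSolutionOn P C γ (Ico 0 T))
    (hR : Tendsto (fun t => γ t 0) (𝓝[<] T) (𝓝 0))
    (hq : Tendsto (fun t => γ t 1 / γ t 0) (𝓝[<] T) (𝓝 L)) :
    Tendsto (fun t => -γ t 2) (𝓝[<] T) atTop := by
  obtain ⟨c, hc1, hc2⟩ := exists_between (force₁_zero_neg P C L)
  have hT₁ := T₁_pos P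
  obtain ⟨a, haT, ha⟩ := eventually_nhdsLT_iff_Ioo.1 ((eventually_Ico_mem_nhds hT).and
    (((tendsto_force₁ (P := P) C hR hq).eventually_lt_const hc1).and
      (eventually_momentum_neg hT h hR hq)))
  have hpos : ∀ t ∈ Ioo a T, 0 < γ t 0 := fun t ht => (h t (mem_of_mem_nhds (ha t ht).1)).1
  have hmono : MonotoneOn (fun t => γ t 2 ^ 2 / 2 + c * T₁ P / 3 * ((γ t 0)⁻¹) ^ 3) (Ioo a T) := by
    refine monotoneOn_Ioo_of_hasDerivAt_nonneg
      (f' := fun t => γ t 2 * ((force₁ P C (γ t 1 / γ t 0) (γ t 0) - c) / γ t 0 ^ 4))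
      (fun t ht => ?_) (fun t ht => ?_)
    · have h0 := hpos t ht
      have := (((h.hasDerivAt_two (ha t ht).1).pow 2).div_const 2).add
        ((((h.hasDerivAt_zero (ha t ht).1).inv h0.ne').pow 3).const_mul (c * T₁ P / 3))
      refine this.congr_deriv ?_
      simp only [Pi.inv_apply, Nat.reduceSub]
      push_cast
      field_simp
      ring
    · refine mul_nonneg_of_nonpos_of_nonpos (ha t ht).2.2.le ?_
      exact div_nonpos_of_nonpos_of_nonneg (sub_nonpos.2 (ha t ht).2.1.le)
        (pow_nonneg (hpos t ht).le 4)
  obtain ⟨t₀, ht₀⟩ : (Ioo a T).Nonempty := nonempty_Ioo.2 haT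
  set D := γ t₀ 2 ^ 2 / 2 + c * T₁ P / 3 * ((γ t₀ 0)⁻¹) ^ 3 with hD
  have hinv : Tendsto (fun t => (γ t 0)⁻¹) (𝓝[<] T) atTop := by
    refine Tendsto.inv_tendsto_nhdsGT_zero ?_
    exact tendsto_nhdsWithin_iff.2 ⟨hR, eventually_radius_pos hT h⟩
  have hbig : Tendsto (fun t => 2 * (D + -(c * T₁ P / 3) * ((γ t 0)⁻¹) ^ 3)) (𝓝[<] T) atTop := by
    refine Tendsto.const_mul_atTop two_pos (tendsto_atTop_add_const_left _ _ ?_)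
    refine Tendsto.const_mul_atTop ?_ ((tendsto_pow_atTop three_ne_zero).comp hinv)
    nlinarith [mul_pos (neg_pos.2 hc2) hT₁]
  have hsq : Tendsto (fun t => γ t 2 ^ 2) (𝓝[<] T) atTop := by
    refine tendsto_atTop_mono' _ ?_ hbig
    filter_upwards [Ioo_mem_nhdsLT ht₀.2] with t ht
    have := hmono ht₀ ⟨ht₀.1.trans ht.1, ht.2⟩ ht.1.le
    simp only at this
    linarith
  refine (Real.tendsto_sqrt_atTop.comp hsq).congr' ?_
  filter_upwards [eventually_momentum_neg hT h hR hq] with t ht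
  simp only [Function.comp_apply]
  rw [Real.sqrt_sq_eq_abs, abs_of_neg ht]

/-- The slope `dz / dR` of the motion in the `(R, z)`-plane. -/
noncomputable def slope (P : Params) (x : Phase) : ℝ := x 3 / T₂ P / (x 2 / T₁ P)

/-- L'Hôpital's rule for P_z/P_R: the factors R⁻⁴ of the two forces cancel. Only the denominator
needs to be known to diverge. -/
theorem tendsto_slope_of_shape (hT : 0 < T) (h : IsSolutionOn P C γ (Ico 0 T))
    (hR : Tendsto (fun t => γ t 0) (𝓝[<] T) (𝓝 0))
    (hq : Tendsto (fun t => γ t 1 / γ t 0) (𝓝[<] T) (𝓝 L)) :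
    Tendsto (fun t => slope P (γ t)) (𝓝[<] T)
      (𝓝 (force₂ P L 0 / T₂ P / (force₁ P C L 0 / T₁ P))) := by
  have hT₁ := T₁_pos P
  have hT₂ := T₂_pos P
  have h1 := lhopital_atTop_nhdsLT (b := T) (f := fun t => -γ t 3) (g := fun t => -γ t 2)
    (f' := fun t => -(force₂ P (γ t 1 / γ t 0) (γ t 0) / γ t 0 ^ 4))
    (g' := fun t => -(force₁ P C (γ t 1 / γ t 0) (γ t 0) / γ t 0 ^ 4))
    (l := force₂ P L 0 / force₁ P C L 0)
    ((eventually_Ico_mem_nhds hT).mono fun t ht => (h.hasDerivAt_three ht).neg)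
    ((eventually_Ico_mem_nhds hT).mono fun t ht => (h.hasDerivAt_two ht).neg)
    ?_ (tendsto_momentum_atTop hT h hR hq) ?_
  · have h2 := h1.const_mul (T₁ P / T₂ P)
    convert h2 using 2
    · unfold slope
      rw [neg_div_neg_eq]
      field_simp
    · field_simp
  · filter_upwards [eventually_radius_pos hT h,
      (tendsto_force₁ (P := P) C hR hq).eventually_lt_const (force₁_zero_neg P C L)] with t ht hf
    exact neg_pos.2 (div_neg_of_neg_of_pos hf (by positivity))
  · refine ((tendsto_force₂ hR hq).div (tendsto_force₁ C hR hq)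
      (force₁_zero_neg P C L).ne).congr' ?_
    filter_upwards [eventually_radius_pos hT h] with t ht
    rw [neg_div_neg_eq, div_div_div_cancel_right₀ (by positivity)]
    rfl

/-- The slope is the quotient of the derivatives of z and R, both of which tend to 0. So its limit
is also the limit L of z/R. -/
theorem tendsto_slope (hT : 0 < T) (h : IsSolutionOn P C γ (Ico 0 T))
    (hR : Tendsto (fun t => γ t 0) (𝓝[<] T) (𝓝 0))
    (hz : Tendsto (fun t => γ t 1) (𝓝[<] T) (𝓝 0))
    (hq : Tendsto (fun t => γ t 1 / γ t 0) (𝓝[<] T) (𝓝 L)) :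
    force₂ P L 0 / T₂ P / (force₁ P C L 0 / T₁ P) = L ∧
      Tendsto (fun t => slope P (γ t)) (𝓝[<] T) (𝓝 L) := by
  have hs := tendsto_slope_of_shape hT h hR hq
  have h1 := HasDerivAt.lhopital_zero_nhdsLT
    ((eventually_Ico_mem_nhds hT).mono fun t ht => h.hasDerivAt_one ht)
    ((eventually_Ico_mem_nhds hT).mono fun t ht => h.hasDerivAt_zero ht)
    ((eventually_momentum_neg hT h hR hq).mono fun t ht =>
      (div_neg_of_neg_of_pos ht (T₁_pos P)).ne) hz hR hs
  have h2 := tendsto_nhds_unique h1 hq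
  exact ⟨h2, h2 ▸ hs⟩

/-- A non-degenerate triangular limiting configuration is a critical point of the potential. -/
theorem shapeRho_limit (hT : 0 < T) (h : IsSolutionOn P C γ (Ico 0 T)) (hL : L ≠ 0)
    (hR : Tendsto (fun t => γ t 0) (𝓝[<] T) (𝓝 0))
    (hz : Tendsto (fun t => γ t 1) (𝓝[<] T) (𝓝 0))
    (hq : Tendsto (fun t => γ t 1 / γ t 0) (𝓝[<] T) (𝓝 L)) :
    P.B * shapeRho L ^ 5 = 16 * P.B₁ * (mu P - 1) := by
  have h1 := (tendsto_slope hT h hR hz hq).1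
  have hF := force₁_zero_neg P C L
  have hT₁ := T₁_pos P
  have hT₂ := T₂_pos P
  have hμ : mu P = 4 * T₁ P / T₂ P := by rw [eq_div_iff hT₂.ne', mu_mul_T₂]
  have hρ := shapeRho_pos L
  rw [div_eq_iff (div_ne_zero hF.ne hT₁.ne')] at h1
  simp only [force₁, force₂] at h1
  rw [hμ]
  generalize shapeRho L = ρ at *
  field_simp at h1 ⊢
  ring_nf at h1 ⊢
  linarith

end Asymptotics

/-! ### The limiting shape and the critical angle of W. -/

section LimitShape

open Set

theorem mu_sub_one_pos (P : Params) : 0 < mu P - 1 := by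
  have := P.M_pos
  have := P.m_pos
  have h : mu P - 1 = 2 * P.M / P.m := by unfold mu; field_simp; ring
  rw [h]; positivity

/-- `r / R` as a function of `q = z / R`. -/
noncomputable def shapeNorm (P : Params) (q : ℝ) : ℝ := √(T₁ P + T₂ P * q ^ 2)

theorem shapeNorm_sq (P : Params) (q : ℝ) : shapeNorm P q ^ 2 = T₁ P + T₂ P * q ^ 2 := by
  have := T₁_pos P
  have := T₂_pos P
  exact Real.sq_sqrt (by positivity)

theorem shapeNorm_pos (P : Params) (q : ℝ) : 0 < shapeNorm P q := by
  have := T₁_pos P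
  have := T₂_pos P
  exact Real.sqrt_pos.2 (by positivity)

@[fun_prop]
theorem continuous_shapeNorm (P : Params) : Continuous (shapeNorm P) := by
  unfold shapeNorm; fun_prop

/-- The angle `θ` as a function of `q = z / R`. -/
noncomputable def shapeAngle (P : Params) (q : ℝ) : ℝ :=
  Real.arcsin (√(T₂ P) * (q / shapeNorm P q))

theorem one_sub_sin_sq_shapeAngle (P : Params) (q : ℝ) :
    1 - (√(T₂ P) * (q / shapeNorm P q)) ^ 2 = T₁ P / shapeNorm P q ^ 2 := by
  have h1 := shapeNorm_pos P q
  have h2 := shapeNorm_sq P q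
  have h3 := Real.sq_sqrt (T₂_pos P).le
  rw [mul_pow, div_pow, h3]
  field_simp
  linarith

theorem sin_shapeAngle (P : Params) (q : ℝ) :
    Real.sin (shapeAngle P q) = √(T₂ P) * (q / shapeNorm P q) := by
  have h1 := one_sub_sin_sq_shapeAngle P q
  have h2 := T₁_pos P
  have h3 : 0 ≤ T₁ P / shapeNorm P q ^ 2 := by positivity
  have h4 : |√(T₂ P) * (q / shapeNorm P q)| ≤ 1 := abs_le_one_iff_mul_self_le_one.2 (by linarith)
  exact Real.sin_arcsin (abs_le.1 h4).1 (abs_le.1 h4).2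

theorem cos_shapeAngle (P : Params) (q : ℝ) :
    Real.cos (shapeAngle P q) = √(T₁ P) / shapeNorm P q := by
  rw [shapeAngle, Real.cos_arcsin, one_sub_sin_sq_shapeAngle, Real.sqrt_div (T₁_pos P).le,
    Real.sqrt_sq (shapeNorm_pos P q).le]

theorem shape_eq_tan (P : Params) (q : ℝ) :
    q = √(T₁ P) / √(T₂ P) * Real.tan (shapeAngle P q) := by
  have h1 := shapeNorm_pos P q
  have h2 := Real.sqrt_pos.2 (T₁_pos P)
  have h3 := Real.sqrt_pos.2 (T₂_pos P)
  rw [Real.tan_eq_sin_div_cos, sin_shapeAngle, cos_shapeAngle]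
  field_simp

/-- The last factor is the value of `kinetic` at R = 0; this is how W enters the limit of v. -/
theorem W_shapeAngle (P : Params) (q : ℝ) :
    W P (shapeAngle P q) = shapeNorm P q ^ 3 * (P.B + 16 * P.B₁ / shapeRho q ^ 3) := by
  have hN := shapeNorm_pos P q
  have hρ := shapeRho_pos q
  have h1 := Real.sqrt_pos.2 (T₁_pos P)
  have h2 : Real.cos (shapeAngle P q) ^ 2 + mu P * Real.sin (shapeAngle P q) ^ 2 =
      (√(T₁ P) * shapeRho q / shapeNorm P q) ^ 2 := by
    rw [sin_shapeAngle, cos_shapeAngle, div_pow, mul_pow, div_pow, div_pow, mul_pow,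
      Real.sq_sqrt (T₁_pos P).le, Real.sq_sqrt (T₂_pos P).le, shapeRho_sq]
    field_simp
    linear_combination q ^ 2 * mu_mul_T₂ P
  rw [W, h2, Real.sqrt_sq (by positivity), cos_shapeAngle]
  change √(T₁ P) ^ 3 * _ = _
  field_simp

/-- The hypothesis says (μ - 1)·16B₁/B = ρ⁵, whose 2/5-th power is ρ² = 1 + 4L². With μT₂ = 4T₁ both
sides are the cos² of the angle of shape L. -/
theorem thetaW_argument {P : Params} {L : ℝ}
    (h : P.B * shapeRho L ^ 5 = 16 * P.B₁ * (mu P - 1)) :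
    mu P / ((mu P - 1) + (mu P - 1) ^ (2 / 5 : ℝ) * (16 * P.B₁ / P.B) ^ (2 / 5 : ℝ)) =
      T₁ P / shapeNorm P L ^ 2 := by
  have hμ := mu_sub_one_pos P
  have hB := P.B_pos
  have hB₁ := P.B₁_pos
  have hT₂ := T₂_pos P
  have hT₁ := T₁_pos P
  have h1 : (mu P - 1) ^ (2 / 5 : ℝ) * (16 * P.B₁ / P.B) ^ (2 / 5 : ℝ) = 1 + 4 * L ^ 2 := by
    rw [← Real.mul_rpow hμ.le (by positivity), ← shapeRho_sq,
      show (mu P - 1) * (16 * P.B₁ / P.B) = shapeRho L ^ 5 by field_simp; linarith,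
      ← Real.rpow_natCast, ← Real.rpow_natCast, ← Real.rpow_mul (shapeRho_pos L).le]
    norm_num
  rw [h1, shapeNorm_sq, div_eq_div_iff (by positivity) (by positivity)]
  linear_combination L ^ 2 * mu_mul_T₂ P

theorem shapeAngle_eq_thetaW {P : Params} {L : ℝ} (hL : 0 ≤ L)
    (h : P.B * shapeRho L ^ 5 = 16 * P.B₁ * (mu P - 1)) : shapeAngle P L = thetaW P := by
  have := shapeNorm_pos P L
  rw [shapeAngle, Real.arcsin_eq_arccos (by positivity), one_sub_sin_sq_shapeAngle, thetaW,
    thetaW_argument h]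

theorem shapeNorm_neg (P : Params) (q : ℝ) : shapeNorm P (-q) = shapeNorm P q := by
  simp [shapeNorm]

theorem shapeRho_neg (q : ℝ) : shapeRho (-q) = shapeRho q := by
  simp [shapeRho]

theorem shapeAngle_neg (P : Params) (q : ℝ) : shapeAngle P (-q) = -shapeAngle P q := by
  rw [shapeAngle, shapeAngle, shapeNorm_neg, ← Real.arcsin_neg]
  congr 1
  ring

theorem W_neg (P : Params) (θ : ℝ) : W P (-θ) = W P θ := by
  simp [W]

theorem shapeAngle_eq_or {P : Params} {L : ℝ}
    (h : P.B * shapeRho L ^ 5 = 16 * P.B₁ * (mu P - 1)) :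
    shapeAngle P L = thetaW P ∨ shapeAngle P L = -thetaW P := by
  rcases le_total 0 L with hL | hL
  · exact Or.inl (shapeAngle_eq_thetaW hL h)
  · right
    rw [← shapeRho_neg] at h
    rw [← shapeAngle_eq_thetaW (neg_nonneg.2 hL) h, shapeAngle_neg, neg_neg]

/-- The condition on μ makes the power term exceed 1, which keeps the argument of arccos below 1 and
so θ_w away from 0. -/
theorem thetaW_mem_Ioo {P : Params} (hμB : 1 + P.B / (16 * P.B₁) < mu P) :
    thetaW P ∈ Ioo 0 (Real.pi / 2) := by
  have hμ := mu_sub_one_pos P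
  have hμ' : 0 < mu P := by linarith
  have hB := P.B_pos
  have hB₁ := P.B₁_pos
  have h1 : 1 < (mu P - 1) ^ (2 / 5 : ℝ) * (16 * P.B₁ / P.B) ^ (2 / 5 : ℝ) := by
    rw [← Real.mul_rpow hμ.le (by positivity)]
    refine Real.one_lt_rpow ?_ (by norm_num)
    have : P.B / (16 * P.B₁) < mu P - 1 := by linarith
    rw [div_lt_iff₀ (by positivity)] at this
    rw [mul_div_assoc', lt_div_iff₀ hB]
    linarith
  rw [thetaW]
  constructor
  · rw [Real.arccos_pos, Real.sqrt_lt' one_pos, div_lt_iff₀ (by linarith)]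
    linarith
  · rw [Real.arccos_lt_pi_div_two]
    refine Real.sqrt_pos.2 (div_pos hμ' (by linarith))

end LimitShape

/-! ### Homographic solutions do not have the limiting shape. -/

section Homographic

open Set

/-- The Newtonian and the Schwarzschild parts of the potential would otherwise share a critical
shape. Equating the two expressions for ρ², with 2/3 = 4/15 + 2/5, contradicts `hgen`. -/
theorem newtonian_balance_ne {P : Params} {L : ℝ}
    (hgen : (mu P - 1) ^ (4 / 15 : ℝ) * (4 * P.A₁ / P.A) ^ (2 / 3 : ℝ)
      ≠ (16 * P.B₁ / P.B) ^ (2 / 5 : ℝ))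
    (h : P.B * shapeRho L ^ 5 = 16 * P.B₁ * (mu P - 1)) :
    P.A * shapeRho L ^ 3 ≠ 4 * P.A₁ * (mu P - 1) := by
  intro h'
  apply hgen
  have hμ := mu_sub_one_pos P
  have hB := P.B_pos
  have hA := P.A_pos
  have hρ := shapeRho_pos L
  rw [show 4 * P.A₁ / P.A = shapeRho L ^ 3 / (mu P - 1) by field_simp; linarith,
    show 16 * P.B₁ / P.B = shapeRho L ^ 5 / (mu P - 1) by field_simp; linarith,
    Real.div_rpow (by positivity) hμ.le, Real.div_rpow (by positivity) hμ.le,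
    ← Real.rpow_natCast, ← Real.rpow_natCast, ← Real.rpow_mul hρ.le, ← Real.rpow_mul hρ.le,
    show (2 / 3 : ℝ) = 4 / 15 + 2 / 5 by norm_num, Real.rpow_add hμ]
  have h1 : 0 < (mu P - 1) ^ (4 / 15 : ℝ) := by positivity
  have h2 : 0 < (mu P - 1) ^ (2 / 5 : ℝ) := by positivity
  field_simp
  norm_num

theorem hasDerivAt_unique_of_eqOn {f g : ℝ → ℝ} {f' g' a b t : ℝ} (hf : HasDerivAt f f' t)
    (hg : HasDerivAt g g' t) (h : ∀ s ∈ Ioo a b, f s = g s) (ht : t ∈ Ioo a b) : f' = g' := by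
  refine (hf.congr_of_eventuallyEq ?_).unique hg
  filter_upwards [Ioo_mem_nhds ht.1 ht.2] with s hs using (h s hs).symm

/-- The ratio z/R is constant along such a solution, so the axial and radial accelerations are in
the ratio q at all times. -/
theorem homographic_shape_ne {P : Params} {L : ℝ} (hL : L ≠ 0)
    (hgen : (mu P - 1) ^ (4 / 15 : ℝ) * (4 * P.A₁ / P.A) ^ (2 / 3 : ℝ)
      ≠ (16 * P.B₁ / P.B) ^ (2 / 5 : ℝ))
    (h : P.B * shapeRho L ^ 5 = 16 * P.B₁ * (mu P - 1))
    {C a b : ℝ} {γ : ℝ → Phase} {ϕ : ℝ → ℝ} (hγ : IsHomographicOn P C γ ϕ (Ioo a b))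
    {t : ℝ} (ht : t ∈ Ioo a b) : |γ t 1| / γ t 0 ≠ |L| := by
  intro hLt
  obtain ⟨hsol, -, φ, ψ, α, β, c, -, hform⟩ := hγ
  have hM := P.M_pos
  have hA₁ := P.A₁_pos
  have hB₁ := P.B₁_pos
  have hT₁ := T₁_pos P
  have hT₂ := T₂_pos P
  have hnhds : ∀ s ∈ Ioo a b, Ioo a b ∈ 𝓝 s := fun s hs => Ioo_mem_nhds hs.1 hs.2
  have hpos : ∀ s ∈ Ioo a b, 0 < γ s 0 := fun s hs => (hsol s hs).1
  have hR : ∀ s ∈ Ioo a b, γ s 0 ^ 2 = φ s ^ 2 * (α ^ 2 + β ^ 2) := by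
    intro s hs
    obtain ⟨-, h1, h2, -⟩ := hform s hs
    have e1 := Real.sin_sq_add_cos_sq (ϕ s)
    have e2 := Real.sin_sq_add_cos_sq (ψ s)
    calc γ s 0 ^ 2 = (γ s 0 * Real.cos (ϕ s)) ^ 2 + (γ s 0 * Real.sin (ϕ s)) ^ 2 := by
          linear_combination -γ s 0 ^ 2 * e1
      _ = φ s ^ 2 * (α ^ 2 + β ^ 2) := by
          rw [h1, h2]
          linear_combination φ s ^ 2 * (α ^ 2 + β ^ 2) * e2
  have hc : c ^ 2 = L ^ 2 * (α ^ 2 + β ^ 2) := by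
    have h1 : γ t 1 ^ 2 = L ^ 2 * γ t 0 ^ 2 := by
      rw [div_eq_iff (hpos t ht).ne'] at hLt
      rw [← sq_abs, hLt, mul_pow, sq_abs]
    rw [hR t ht, (hform t ht).2.2.2] at h1
    have h2 : 0 < φ t ^ 2 := by have := (hform t ht).1; positivity
    have h3 : φ t ^ 2 * (c ^ 2 - L ^ 2 * (α ^ 2 + β ^ 2)) = 0 := by linarith
    linarith [(mul_eq_zero.1 h3).resolve_left h2.ne']
  have hq2 : ∀ s ∈ Ioo a b, (γ s 1 / γ s 0) ^ 2 = L ^ 2 := by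
    intro s hs
    have h1 := hpos s hs
    rw [div_pow, div_eq_iff (by positivity), hR s hs, (hform s hs).2.2.2, mul_pow, hc]
    ring
  obtain ⟨q, hq0, hqρ, hq⟩ : ∃ q : ℝ, q ≠ 0 ∧ shapeRho q = shapeRho L ∧
      ∀ s ∈ Ioo a b, γ s 1 / γ s 0 = q := by
    have hcont : ContinuousOn (fun s => γ s 1 / γ s 0) (Ioo a b) := fun s hs =>
      ((hsol.hasDerivAt_one (hnhds s hs)).continuousAt.div
        (hsol.hasDerivAt_zero (hnhds s hs)).continuousAt (hpos s hs).ne').continuousWithinAt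
    -- Only (z/R)² = L² is known; continuity on an interval fixes the sign.
    rcases isPreconnected_Ioo.eq_or_eq_neg_of_sq_eq hcont (continuousOn_const (c := L))
      (fun s hs => hq2 s hs) (fun _ => hL) with h1 | h1
    · exact ⟨L, hL, rfl, fun s hs => h1 hs⟩
    · exact ⟨-L, neg_ne_zero.2 hL, shapeRho_neg L, fun s hs => h1 hs⟩
  have hv : ∀ s ∈ Ioo a b, γ s 3 / T₂ P = q * (γ s 2 / T₁ P) := fun s hs =>
    hasDerivAt_unique_of_eqOn (hsol.hasDerivAt_one (hnhds s hs))
      ((hsol.hasDerivAt_zero (hnhds s hs)).const_mul q)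
      (fun r hr => (div_eq_iff (hpos r hr).ne').1 (hq r hr)) hs
  have hF : ∀ s ∈ Ioo a b, force₂ P q (γ s 0) / T₂ P = q * (force₁ P C q (γ s 0) / T₁ P) := by
    intro s hs
    have h1 := hasDerivAt_unique_of_eqOn ((hsol.hasDerivAt_three (hnhds s hs)).div_const (T₂ P))
      (((hsol.hasDerivAt_two (hnhds s hs)).div_const (T₁ P)).const_mul q) hv hs
    have h2 : 0 < γ s 0 ^ 4 := pow_pos (hpos s hs) 4
    rw [hq s hs] at h1
    field_simp at h1 ⊢
    exact (div_left_inj' h2.ne').1 h1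
  have hρ := shapeRho_pos L
  have hμ : mu P = 4 * T₁ P / T₂ P := by rw [eq_div_iff hT₂.ne', mu_mul_T₂]
  -- The B terms cancel by `h`. After division by R the Newtonian and centrifugal terms leave a
  -- linear equation, which determines R.
  have hbal : ∀ s ∈ Ioo a b, γ s 0 * (P.A * shapeRho L ^ 3 - 4 * P.A₁ * (mu P - 1)) =
      2 * C ^ 2 / P.M * shapeRho L ^ 3 := by
    intro s hs
    have h1 := hF s hs
    have h0 := hpos s hs
    simp only [force₁, force₂, hqρ] at h1
    rw [hμ] at h ⊢
    generalize shapeRho L = ρ at *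
    generalize γ s 0 = R at *
    have h3 : (ρ ^ 2 * R * T₂ P * P.M) * (R * (P.A * ρ ^ 3 - 4 * P.A₁ * (4 * T₁ P / T₂ P - 1)) -
        2 * C ^ 2 / P.M * ρ ^ 3) = 0 := by
      field_simp at h1 h ⊢
      ring_nf at h1 h ⊢
      linear_combination h1 - 3 * P.M * h
    have h4 : (ρ ^ 2 * R * T₂ P * P.M) ≠ 0 := by positivity
    linarith [(mul_eq_zero.1 h3).resolve_left h4]
  have hne := sub_ne_zero.2 (newtonian_balance_ne hgen h)
  have hconst : ∀ s ∈ Ioo a b, γ s 0 = 2 * C ^ 2 / P.M * shapeRho L ^ 3 /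
      (P.A * shapeRho L ^ 3 - 4 * P.A₁ * (mu P - 1)) := fun s hs =>
    eq_div_of_mul_eq hne (hbal s hs)
  have hp : ∀ s ∈ Ioo a b, γ s 2 = 0 := by
    intro s hs
    have := hasDerivAt_unique_of_eqOn (hsol.hasDerivAt_zero (hnhds s hs)) (hasDerivAt_const s _)
      hconst hs
    exact (div_eq_zero_iff.1 this).resolve_right hT₁.ne'
  -- Constant R gives P_R = 0 and zero radial force. Then `hF` makes the axial force vanish too,
  -- which is impossible for q ≠ 0.
  have hf1 := hasDerivAt_unique_of_eqOn (hsol.hasDerivAt_two (hnhds t ht)) (hasDerivAt_const t _)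
    hp ht
  have h0 := hpos t ht
  have hf2 := hF t ht
  rw [hq t ht] at hf1
  rw [(div_eq_zero_iff.1 hf1).resolve_right (by positivity), zero_div, mul_zero, force₂] at hf2
  have h5 := (div_eq_zero_iff.1 hf2).resolve_right hT₂.ne'
  have h6 := shapeRho_pos q
  have h7 : 0 < 4 * P.A₁ * γ t 0 ^ 2 / shapeRho q ^ 3 + 48 * P.B₁ / shapeRho q ^ 5 := by positivity
  exact mul_ne_zero (neg_ne_zero.2 h7.ne') (mul_ne_zero four_ne_zero hq0) h5

end Homographic

/-! ### Collision orbits in the variables (r, v, θ, w). -/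

section McGehee

open Set

variable {P : Params} {C L : ℝ} {γ : ℝ → Phase} {T : ℝ} {x : Phase}

theorem rCoord_eq (hx : 0 < x 0) : rCoord P x = x 0 * shapeNorm P (x 1 / x 0) := by
  have := T₁_pos P
  have := T₂_pos P
  rw [rCoord, shapeNorm, show T₁ P * x 0 ^ 2 + T₂ P * x 1 ^ 2 =
    x 0 ^ 2 * (T₁ P + T₂ P * (x 1 / x 0) ^ 2) by field_simp, Real.sqrt_mul (by positivity),
    Real.sqrt_sq hx.le]

theorem zero_div_rCoord (hx : 0 < x 0) : x 0 / rCoord P x = 1 / shapeNorm P (x 1 / x 0) := by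
  have := shapeNorm_pos P (x 1 / x 0)
  rw [rCoord_eq hx]
  field_simp

theorem one_div_rCoord (hx : 0 < x 0) :
    x 1 / rCoord P x = x 1 / x 0 / shapeNorm P (x 1 / x 0) := by
  rw [rCoord_eq hx, div_div]

theorem thetaCoord_eq (hx : 0 < x 0) : thetaCoord P x = shapeAngle P (x 1 / x 0) := by
  rw [thetaCoord, one_div_rCoord hx, shapeAngle]

/-- The radial velocity `dR/dt`, scaled by `R^{3/2}`. -/
noncomputable def scaledVelocity (P : Params) (x : Phase) : ℝ := x 0 ^ (3 / 2 : ℝ) * (x 2 / T₁ P)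

theorem three_eq (hp : x 2 ≠ 0) : x 3 = T₂ P * slope P x * (x 2 / T₁ P) := by
  have := T₁_pos P
  have := T₂_pos P
  unfold slope
  field_simp

theorem sDotP_eq (hx : 0 < x 0) (hp : x 2 ≠ 0) : sDotP P x =
    x 2 / T₁ P * ((T₁ P + T₂ P * (x 1 / x 0 * slope P x)) / shapeNorm P (x 1 / x 0)) := by
  have h1 := T₁_pos P
  have h2 := T₂_pos P
  rw [sDotP, zero_div_rCoord hx, one_div_rCoord hx, three_eq (P := P) hp]
  field_simp

theorem vCoord_eq (hx : 0 < x 0) (hp : x 2 ≠ 0) : vCoord P x =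
    scaledVelocity P x * shapeNorm P (x 1 / x 0) ^ (3 / 2 : ℝ) *
      ((T₁ P + T₂ P * (x 1 / x 0 * slope P x)) / shapeNorm P (x 1 / x 0)) := by
  rw [vCoord, sDotP_eq hx hp, rCoord_eq hx, Real.mul_rpow hx.le (shapeNorm_pos P _).le,
    scaledVelocity]
  ring

/-- Apart from the scaled radial velocity, everything is a continuous function of z/R and the slope,
whose limits are known. -/
theorem uCoord_eq (hx : 0 < x 0) (hp : x 2 ≠ 0) : uCoord P x =
    scaledVelocity P x * (shapeNorm P (x 1 / x 0) ^ (3 / 2 : ℝ) *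
      (√(T₁ P) * (1 - (T₁ P + T₂ P * (x 1 / x 0 * slope P x)) / shapeNorm P (x 1 / x 0) ^ 2)
          * (-Real.sin (shapeAngle P (x 1 / x 0)))
        + √(T₂ P) * (slope P x - (T₁ P + T₂ P * (x 1 / x 0 * slope P x)) * (x 1 / x 0)
          / shapeNorm P (x 1 / x 0) ^ 2) * Real.cos (shapeAngle P (x 1 / x 0)))) := by
  have h2 := T₂_pos P
  have hN := shapeNorm_pos P (x 1 / x 0)
  have h3 : x 3 / T₂ P = slope P x * (x 2 / T₁ P) := by
    rw [three_eq (P := P) hp]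
    field_simp
  rw [uCoord, sDotP_eq hx hp, thetaCoord_eq hx, one_div_rCoord hx, zero_div_rCoord hx, h3,
    rCoord_eq hx, Real.mul_rpow hx.le hN.le, scaledVelocity]
  generalize shapeNorm P (x 1 / x 0) ^ (3 / 2 : ℝ) = N'
  generalize x 0 ^ (3 / 2 : ℝ) = R'
  generalize x 1 / x 0 = q at *
  field_simp

/-- The energy integral gives the size of the velocity once its direction, the slope, is known; P_R
< 0 gives the sign. -/
theorem scaledVelocity_eq {h : ℝ} (hx : 0 < x 0) (hp : x 2 < 0) (hh : hamiltonian P C x = h) :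
    scaledVelocity P x =
      -√(2 * kinetic P C h (x 1 / x 0) (x 0) / (T₁ P + T₂ P * slope P x ^ 2)) := by
  have h1 := T₁_pos P
  have h2 := T₂_pos P
  have hneg : scaledVelocity P x < 0 :=
    mul_neg_of_pos_of_neg (by positivity) (div_neg_of_neg_of_pos hp h1)
  have hsq : scaledVelocity P x ^ 2 =
      2 * kinetic P C h (x 1 / x 0) (x 0) / (T₁ P + T₂ P * slope P x ^ 2) := by
    rw [kinetic_eq_of_hamiltonian_eq hx hh, scaledVelocity, mul_pow, ← Real.rpow_natCast,
      ← Real.rpow_mul hx.le, three_eq (P := P) hp.ne]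
    norm_num
    field_simp
  rw [← hsq, Real.sqrt_sq_eq_abs, abs_of_neg hneg, neg_neg]

theorem continuousAt_W {θ : ℝ} (hθ : Real.cos θ ≠ 0) : ContinuousAt (W P) θ := by
  have hμ := mu_sub_one_pos P
  have hμ' : 0 < mu P := by linarith
  have h1 : √(Real.cos θ ^ 2 + mu P * Real.sin θ ^ 2) ≠ 0 := by
    have : 0 < Real.cos θ ^ 2 := by positivity
    exact (Real.sqrt_pos.2 (by positivity)).ne'
  unfold W
  fun_prop (disch := first | exact pow_ne_zero 3 hθ | exact pow_ne_zero 3 h1)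

/-- In the variables `(r, v, θ, w)`, an orbit that ends in triple collision with a non-degenerate
limiting shape tends to an equilibrium. -/
theorem tendsto_mcGehee (hT : 0 < T) (h : IsSolutionOn P C γ (Ico 0 T))
    (hR : Tendsto (fun t => γ t 0) (𝓝[<] T) (𝓝 0))
    (hz : Tendsto (fun t => γ t 1) (𝓝[<] T) (𝓝 0))
    (hq : Tendsto (fun t => γ t 1 / γ t 0) (𝓝[<] T) (𝓝 L)) :
    Tendsto (fun t => mcGehee P (γ t)) (𝓝[<] T)
      (𝓝 (0, -√(2 * W P (shapeAngle P L)), shapeAngle P L, 0)) := by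
  have h1 := T₁_pos P
  have h2 := T₂_pos P
  have hN := shapeNorm_pos P L
  have hs := (tendsto_slope hT h hR hz hq).2
  have hpos := eventually_radius_pos hT h
  have hneg := eventually_momentum_neg hT h hR hq
  set E := hamiltonian P C (γ 0)
  have hNt : Tendsto (fun t => shapeNorm P (γ t 1 / γ t 0)) (𝓝[<] T) (𝓝 (shapeNorm P L)) :=
    ((continuous_shapeNorm P).tendsto L).comp hq
  have hNt' := hNt.rpow_const (p := 3 / 2) (Or.inl hN.ne')
  have hcos : 0 < Real.cos (shapeAngle P L) := by
    rw [cos_shapeAngle]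
    have := Real.sqrt_pos.2 h1
    positivity
  have hvel : Tendsto (fun t => scaledVelocity P (γ t)) (𝓝[<] T)
      (𝓝 (-√(2 * kinetic P C E L 0 / (T₁ P + T₂ P * L ^ 2)))) := by
    have hk : Tendsto (fun t => kinetic P C E (γ t 1 / γ t 0) (γ t 0)) (𝓝[<] T)
        (𝓝 (kinetic P C E L 0)) := tendsto_uncurried (continuous_kinetic P C E) hq hR
    refine (((hk.const_mul 2).div (((hs.pow 2).const_mul (T₂ P)).const_add (T₁ P))
      (by positivity)).sqrt.neg).congr' ?_
    filter_upwards [hpos, hneg, eventually_Ico_mem_nhds hT] with t ht0 ht2 ht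
    rw [scaledVelocity_eq ht0 ht2 (h.hamiltonian_eq (mem_of_mem_nhds ht))]
    rfl
  have hnum := ((hq.mul hs).const_mul (T₂ P)).const_add (T₁ P)
  have hθ : Tendsto (fun t => shapeAngle P (γ t 1 / γ t 0)) (𝓝[<] T) (𝓝 (shapeAngle P L)) := by
    refine (Real.continuous_arcsin.tendsto _).comp ((hq.div hNt hN.ne').const_mul _)
  have hr : Tendsto (fun t => rCoord P (γ t)) (𝓝[<] T) (𝓝 0) := by
    have := hR.mul hNt
    rw [zero_mul] at this
    exact this.congr' (hpos.mono fun t ht => (rCoord_eq ht).symm)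
  have hv : Tendsto (fun t => vCoord P (γ t)) (𝓝[<] T)
      (𝓝 (-√(2 * W P (shapeAngle P L)))) := by
    have h3 := (hvel.mul hNt').mul (hnum.div hNt hN.ne')
    have h4 : -√(2 * kinetic P C E L 0 / (T₁ P + T₂ P * L ^ 2)) * shapeNorm P L ^ (3 / 2 : ℝ)
        * ((T₁ P + T₂ P * (L * L)) / shapeNorm P L) = -√(2 * W P (shapeAngle P L)) := by
      have hk := kinetic_zero_pos P C E L
      have h5 : √(shapeNorm P L ^ 3) = shapeNorm P L ^ (3 / 2 : ℝ) := by
        rw [Real.sqrt_eq_rpow, ← Real.rpow_natCast, ← Real.rpow_mul hN.le]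
        norm_num
      rw [W_shapeAngle, ← kinetic_zero P C E, ← pow_two, ← shapeNorm_sq,
        Real.sqrt_div (by positivity), Real.sqrt_sq hN.le,
        show 2 * (shapeNorm P L ^ 3 * kinetic P C E L 0) =
          2 * kinetic P C E L 0 * shapeNorm P L ^ 3 by ring,
        Real.sqrt_mul (show 0 ≤ 2 * kinetic P C E L 0 by positivity), h5]
      field_simp
    rw [h4] at h3
    refine h3.congr' ?_
    filter_upwards [hpos, hneg] with t ht0 ht2 using (vCoord_eq ht0 ht2.ne).symm
  have hu : Tendsto (fun t => uCoord P (γ t)) (𝓝[<] T) (𝓝 0) := by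
    have hsin := (Real.continuous_sin.tendsto _).comp hθ
    have hcos := (Real.continuous_cos.tendsto _).comp hθ
    have hN2 := (hNt.pow 2)
    have hN2' : shapeNorm P L ^ 2 ≠ 0 := by positivity
    have h3 := hvel.mul (hNt'.mul ((((((hnum.div hN2 hN2').const_sub 1)).const_mul
      √(T₁ P)).mul hsin.neg).add (((hs.sub ((hnum.mul hq).div hN2 hN2')).const_mul
      √(T₂ P)).mul hcos)))
    -- Shape and slope have the same limit, so the velocity becomes parallel to the position and its
    -- tangential part u vanishes.
    have e1 : (T₁ P + T₂ P * (L * L)) / shapeNorm P L ^ 2 = 1 := by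
      rw [← pow_two, ← shapeNorm_sq, div_self hN2']
    have e2 : (T₁ P + T₂ P * (L * L)) * L / shapeNorm P L ^ 2 = L := by
      rw [← pow_two, ← shapeNorm_sq, mul_div_cancel_left₀ _ hN2']
    rw [e1, e2, sub_self, sub_self, mul_zero, mul_zero, zero_mul, zero_mul, add_zero, mul_zero,
      mul_zero] at h3
    refine h3.congr' ?_
    filter_upwards [hpos, hneg] with t ht0 ht2
    rw [uCoord_eq ht0 ht2.ne]
    rfl
  have hθ' : Tendsto (fun t => thetaCoord P (γ t)) (𝓝[<] T) (𝓝 (shapeAngle P L)) :=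
    hθ.congr' (hpos.mono fun t ht => (thetaCoord_eq ht).symm)
  have hw : Tendsto (fun t => wCoord P (γ t)) (𝓝[<] T) (𝓝 0) := by
    have hc3 := ((Real.continuous_cos.tendsto _).comp hθ').pow 3
    have hWt := (continuousAt_W (P := P) hcos.ne').tendsto.comp hθ'
    have hWpos : 0 < W P (shapeAngle P L) := by
      have := P.B_pos
      have := P.B₁_pos
      have := shapeRho_pos L
      rw [W_shapeAngle]
      positivity
    have := (hc3.div (hWt.mul hc3).sqrt (Real.sqrt_pos.2 (by positivity)).ne').mul hu
    rw [mul_zero] at this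
    exact this
  exact hr.prodMk_nhds (hv.prodMk_nhds (hθ'.prodMk_nhds hw))

/-- This follows from z/R = √(T₁/T₂) tan θ and R = r cos θ/√T₁, as tan is continuous at ϑ. -/
theorem tripleCollisionWithShape_of_tendsto {ϑ : ℝ} (hϑ : ϑ ∈ Ioo (-(Real.pi / 2)) (Real.pi / 2))
    (hT : 0 < T) (h : IsSolutionOn P C γ (Ico 0 T))
    (hr : Tendsto (fun t => rCoord P (γ t)) (𝓝[<] T) (𝓝 0))
    (hθ : Tendsto (fun t => thetaCoord P (γ t)) (𝓝[<] T) (𝓝 ϑ)) :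
    TripleCollisionWithShape P C (γ 0) (√(T₁ P) / √(T₂ P) * Real.tan ϑ) := by
  have hpos := eventually_radius_pos hT h
  have h1 := Real.sqrt_pos.2 (T₁_pos P)
  have hcos : Real.cos ϑ ≠ 0 := (Real.cos_pos_of_mem_Ioo hϑ).ne'
  have hθ' : Tendsto (fun t => shapeAngle P (γ t 1 / γ t 0)) (𝓝[<] T) (𝓝 ϑ) :=
    hθ.congr' (hpos.mono fun t ht => thetaCoord_eq ht)
  have hq : Tendsto (fun t => γ t 1 / γ t 0) (𝓝[<] T) (𝓝 (√(T₁ P) / √(T₂ P) * Real.tan ϑ)) := by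
    have := ((Real.continuousAt_tan.2 hcos).tendsto.comp hθ').const_mul (√(T₁ P) / √(T₂ P))
    exact this.congr fun t => (shape_eq_tan P _).symm
  have hR : Tendsto (fun t => γ t 0) (𝓝[<] T) (𝓝 0) := by
    have := (hr.mul ((Real.continuous_cos.tendsto _).comp hθ')).div_const √(T₁ P)
    rw [zero_mul, zero_div] at this
    refine this.congr' (hpos.mono fun t ht => ?_)
    have := shapeNorm_pos P (γ t 1 / γ t 0)
    simp only [Function.comp_apply]
    rw [cos_shapeAngle, rCoord_eq ht]
    field_simp
  refine ⟨T, γ, hT, rfl, h, hR, ?_, hq⟩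
  have := hq.mul hR
  rw [mul_zero] at this
  exact this.congr' (hpos.mono fun t ht => div_mul_cancel₀ _ ht.ne')

theorem triangularTripleCollision_iff (hμB : 1 + P.B / (16 * P.B₁) < mu P) :
    TriangularTripleCollision P C x ↔
      OrbitTendsTo P C x (EstarPlus P) ∨ OrbitTendsTo P C x (EstarMinus P) := by
  have h1 := Real.sqrt_pos.2 (T₁_pos P)
  have h2 := Real.sqrt_pos.2 (T₂_pos P)
  obtain ⟨hθ0, hθ1⟩ := thetaW_mem_Ioo hμB
  constructor
  · rintro ⟨L, hL, T, γ, hT, h0, h, hR, hz, hq⟩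
    have := tendsto_mcGehee hT h hR hz hq
    rcases shapeAngle_eq_or (shapeRho_limit hT h hL hR hz hq) with hθ | hθ
    · rw [hθ] at this
      exact Or.inl ⟨T, γ, hT, h0, h, this⟩
    · rw [hθ, W_neg] at this
      exact Or.inr ⟨T, γ, hT, h0, h, this⟩
  -- The limits of v and w play no part in this direction.
  · have key : ∀ ϑ v w : ℝ, ϑ ≠ 0 → ϑ ∈ Ioo (-(Real.pi / 2)) (Real.pi / 2) →
        OrbitTendsTo P C x (0, v, ϑ, w) → TriangularTripleCollision P C x := by
      rintro ϑ v w hϑ0 hϑ ⟨T, γ, hT, rfl, h, hlim⟩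
      have hθ := hlim.snd_nhds.snd_nhds.fst_nhds
      refine ⟨_, ?_, tripleCollisionWithShape_of_tendsto hϑ hT h hlim.fst_nhds hθ⟩
      refine mul_ne_zero (by positivity) ?_
      rw [← Real.tan_zero]
      exact fun heq => hϑ0
        (Real.injOn_tan hϑ ⟨by linarith [Real.pi_pos], by linarith [Real.pi_pos]⟩ heq)
    rintro (h | h)
    · exact key _ _ _ hθ0.ne' ⟨by linarith, hθ1⟩ h
    · exact key _ _ _ (neg_ne_zero.2 hθ0.ne') ⟨by linarith, by linarith⟩ h

end McGehee

/-! ### Cone condition at a saddle. -/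

section Cone

open Set

/-- `y = (q, σ, R)` solves `q' = q - σ`, `σ' = G(q, σ, R)`, `R' = -R` for all positive times. -/
def IsShapeOrbit (G : ℝ × ℝ × ℝ → ℝ) (y : ℝ → ℝ × ℝ × ℝ) : Prop :=
  ∀ s, 0 ≤ s → HasDerivAt (fun s => (y s).1) ((y s).1 - (y s).2.1) s ∧
    HasDerivAt (fun s => (y s).2.1) (G (y s)) s ∧ HasDerivAt (fun s => (y s).2.2) (-(y s).2.2) s

theorem le_zero_of_deriv_nonneg_of_tendsto_zero {f f' : ℝ → ℝ}
    (hf : ∀ s, 0 ≤ s → HasDerivAt f (f' s) s) (hf' : ∀ s, 0 ≤ s → 0 ≤ f' s)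
    (hlim : Tendsto f atTop (𝓝 0)) : f 0 ≤ 0 := by
  have hmono : MonotoneOn f (Ici 0) := by
    refine monotoneOn_of_deriv_nonneg (convex_Ici 0)
      (fun t ht => (hf t ht).continuousAt.continuousWithinAt) ?_ ?_
    · rw [interior_Ici]
      exact fun t ht => (hf t ht.le).differentiableAt.differentiableWithinAt
    · rw [interior_Ici]
      intro t ht
      rw [(hf t ht.le).deriv]
      exact hf' t ht.le
  refine ge_of_tendsto hlim ?_
  filter_upwards [eventually_ge_atTop 0] with s hs using hmono self_mem_Ici hs hs

/-- The expression is the derivative of the cone form along the difference of two orbits. By Young's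
inequality the cross term in x and r costs k/2·x² and 2c²/k·r²; the nonlinear error costs k·x² + d²
+ r², which is where 6ε ≤ k is needed. -/
theorem cone_form_deriv_nonneg {k c ε x d r e : ℝ} (hk : 0 < k) (hε0 : 0 < ε) (hε1 : ε ≤ 1)
    (hεk : 6 * ε ≤ k) (he : |e| ≤ ε * (2 * |x| + |d| + |r|)) :
    0 ≤ 2 * d ^ 2 + 2 * k * x ^ 2 - 2 * x * (c * r + e) + 2 * (c ^ 2 / k + 1) * r ^ 2 := by
  have h1 : x * e ≤ ε * (2 * |x| ^ 2 + |x| * |d| + |x| * |r|) := by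
    calc x * e ≤ |x * e| := le_abs_self _
      _ = |x| * |e| := abs_mul _ _
      _ ≤ |x| * (ε * (2 * |x| + |d| + |r|)) := by gcongr
      _ = _ := by ring
  have h2 : |x| * |d| ≤ (x ^ 2 + d ^ 2) / 2 := by
    rw [← sq_abs x, ← sq_abs d]; nlinarith [sq_nonneg (|x| - |d|)]
  have h3 : |x| * |r| ≤ (x ^ 2 + r ^ 2) / 2 := by
    rw [← sq_abs x, ← sq_abs r]; nlinarith [sq_nonneg (|x| - |r|)]
  have h4 : 2 * x * e ≤ k * x ^ 2 + d ^ 2 + r ^ 2 := by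
    rw [sq_abs] at h1
    have h5 : ε * (2 * x ^ 2 + |x| * |d| + |x| * |r|) ≤
        ε * (2 * x ^ 2 + (x ^ 2 + d ^ 2) / 2 + (x ^ 2 + r ^ 2) / 2) := by gcongr
    nlinarith [mul_le_mul_of_nonneg_right hεk (sq_nonneg x),
      mul_le_mul_of_nonneg_right hε1 (sq_nonneg d), mul_le_mul_of_nonneg_right hε1 (sq_nonneg r)]
  have h6 : 2 * x * (c * r) ≤ k / 2 * x ^ 2 + 2 * (c ^ 2 / k) * r ^ 2 := by
    have h7 : 0 ≤ (k * x - 2 * (c * r)) ^ 2 / (2 * k) := by positivity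
    have h8 : (k * x - 2 * (c * r)) ^ 2 / (2 * k) =
        k / 2 * x ^ 2 - 2 * x * (c * r) + 2 * (c ^ 2 / k) * r ^ 2 := by
      field_simp; ring
    linarith
  nlinarith [sq_nonneg d, sq_nonneg r, mul_nonneg hk.le (sq_nonneg x)]

theorem clm_apply_triple (A : ℝ × ℝ × ℝ →L[ℝ] ℝ) (y : ℝ × ℝ × ℝ) :
    A y = y.1 * A (1, 0, 0) + y.2.1 * A (0, 1, 0) + y.2.2 * A (0, 0, 1) := by
  obtain ⟨a, b, c⟩ := y
  have : ((a, b, c) : ℝ × ℝ × ℝ) = a • (1, 0, 0) + b • (0, 1, 0) + c • (0, 0, 1) := by simp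
  rw [this, map_add, map_add, map_smul, map_smul, map_smul]
  simp

/-- Two orbits that tend to a saddle without leaving a small neighbourhood of it lie in a cone
about the stable directions. -/
theorem exists_cone {G : ℝ × ℝ × ℝ → ℝ} {A : ℝ × ℝ × ℝ →L[ℝ] ℝ} {E : ℝ × ℝ × ℝ}
    (hG : HasStrictFDerivAt G A E) (hA : A (1, 1, 0) < 0) :
    ∃ U ∈ 𝓝 E, ∃ e K : ℝ, ∀ y₁ y₂ : ℝ → ℝ × ℝ × ℝ, IsShapeOrbit G y₁ → IsShapeOrbit G y₂ →
      (∀ s, 0 ≤ s → y₁ s ∈ U) → (∀ s, 0 ≤ s → y₂ s ∈ U) →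
      Tendsto y₁ atTop (𝓝 E) → Tendsto y₂ atTop (𝓝 E) →
      -2 * ((y₁ 0).1 - (y₂ 0).1) * (((y₁ 0).2.1 - (y₂ 0).2.1) - ((y₁ 0).1 - (y₂ 0).1))
        - e * ((y₁ 0).1 - (y₂ 0).1) ^ 2 - K * ((y₁ 0).2.2 - (y₂ 0).2.2) ^ 2 ≤ 0 := by
  -- With x = Δq and d = Δ(σ - q) the linear part is x' = -d, d' = -kx + (1 + b)d + cr. The (x, d)
  -- block has determinant -k < 0, hence a saddle.
  set k := -A (1, 1, 0) with hk
  have hk0 : 0 < k := neg_pos.2 hA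
  set ε := min 1 (k / 6) with hε
  have hε0 : 0 < ε := lt_min one_pos (by positivity)
  have hεk : 6 * ε ≤ k := by
    have := min_le_right 1 (k / 6)
    linarith
  have hk' : A (1, 0, 0) + A (0, 1, 0) = -k := by
    rw [hk, clm_apply_triple A (1, 1, 0)]; simp
  -- Strict differentiability bounds the error by the difference of two nearby orbits, not by their
  -- distances to the saddle.
  have hlo := hG.isLittleO.def hε0
  rw [nhds_prod_eq, eventually_prod_self_iff'] at hlo
  obtain ⟨U, hU, hUε⟩ := hlo
  set b := A (0, 1, 0) with hb
  set c := A (0, 0, 1) with hc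
  -- The coefficient 1 + b of x² cancels the products x·d in the derivative of the form.
  refine ⟨U, hU, 1 + b, c ^ 2 / k + 1, fun y₁ y₂ h₁ h₂ hU₁ hU₂ hl₁ hl₂ => ?_⟩
  set x : ℝ → ℝ := fun s => (y₁ s).1 - (y₂ s).1 with hx
  set d : ℝ → ℝ := fun s => (y₁ s).2.1 - (y₂ s).2.1 - ((y₁ s).1 - (y₂ s).1) with hd
  set r : ℝ → ℝ := fun s => (y₁ s).2.2 - (y₂ s).2.2 with hr
  set err : ℝ → ℝ := fun s => G (y₁ s) - G (y₂ s) - A (y₁ s - y₂ s) with herr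
  have hx' : ∀ s, 0 ≤ s → HasDerivAt x (-d s) s := fun s hs =>
    ((h₁ s hs).1.sub (h₂ s hs).1).congr_deriv (by simp only [hd]; ring)
  have hr' : ∀ s, 0 ≤ s → HasDerivAt r (-r s) s := fun s hs =>
    ((h₁ s hs).2.2.sub (h₂ s hs).2.2).congr_deriv (by simp only [hr]; ring)
  have hd' : ∀ s, 0 ≤ s → HasDerivAt d (-k * x s + (1 + b) * d s + (c * r s + err s)) s := by
    intro s hs
    refine (((h₁ s hs).2.1.sub (h₂ s hs).2.1).sub (hx' s hs)).congr_deriv ?_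
    have hA₁ : A (1, 0, 0) = -k - b := by linarith
    have : A (y₁ s - y₂ s) = x s * (-k - b) + (x s + d s) * b + r s * c := by
      rw [clm_apply_triple, hA₁]
      simp only [hx, hd, hr, hb, hc, Prod.fst_sub, Prod.snd_sub]
      ring
    simp only [herr, this]
    ring
  have herr' : ∀ s, 0 ≤ s → |err s| ≤ ε * (2 * |x s| + |d s| + |r s|) := by
    intro s hs
    refine (hUε _ (hU₁ s hs) _ (hU₂ s hs)).trans ?_
    gcongr
    have h3 : |(y₁ s).2.1 - (y₂ s).2.1| ≤ |d s| + |x s| := by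
      have := abs_add_le (d s) (x s)
      simpa [hx, hd] using this
    rw [Prod.norm_def, Prod.norm_def]
    simp only [Prod.fst_sub, Prod.snd_sub, Real.norm_eq_abs]
    have := abs_nonneg (x s)
    have := abs_nonneg (d s)
    have := abs_nonneg (r s)
    refine max_le ?_ (max_le ?_ ?_)
    · change |x s| ≤ _
      linarith
    · linarith
    · change |r s| ≤ _
      linarith
  have hlim : Tendsto (fun s => -2 * x s * d s - (1 + b) * x s ^ 2 - (c ^ 2 / k + 1) * r s ^ 2)
      atTop (𝓝 0) := by
    have hx0 : Tendsto x atTop (𝓝 0) := by simpa using hl₁.fst_nhds.sub hl₂.fst_nhds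
    have hd0 : Tendsto d atTop (𝓝 0) := by
      simpa using (hl₁.snd_nhds.fst_nhds.sub hl₂.snd_nhds.fst_nhds).sub hx0
    have hr0 : Tendsto r atTop (𝓝 0) := by
      simpa using hl₁.snd_nhds.snd_nhds.sub hl₂.snd_nhds.snd_nhds
    simpa using (((hx0.const_mul (-2)).mul hd0).sub ((hx0.pow 2).const_mul (1 + b))).sub
      ((hr0.pow 2).const_mul (c ^ 2 / k + 1))
  refine le_zero_of_deriv_nonneg_of_tendsto_zero
    (f := fun s => -2 * x s * d s - (1 + b) * x s ^ 2 - (c ^ 2 / k + 1) * r s ^ 2)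
    (fun s hs => ?_) (fun s hs => cone_form_deriv_nonneg (c := c) hk0 hε0 (min_le_left _ _) hεk
      (herr' s hs)) hlim
  refine (((((hx' s hs).const_mul (-2)).mul (hd' s hs)).sub
    (((hx' s hs).pow 2).const_mul (1 + b))).sub
    (((hr' s hs).pow 2).const_mul (c ^ 2 / k + 1))).congr_deriv ?_
  simp only [Nat.reduceSub, pow_one]
  push_cast
  ring

/-- A set whose points lie in cones about a plane has at most the dimension of the plane. -/
theorem dimH_le_two_of_cone {S : Set (ℝ × ℝ × ℝ)} {e K : ℝ}
    (h : ∀ y₁ ∈ S, ∀ y₂ ∈ S, -2 * (y₁.1 - y₂.1) * ((y₁.2.1 - y₂.2.1) - (y₁.1 - y₂.1))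
        - e * (y₁.1 - y₂.1) ^ 2 - K * (y₁.2.2 - y₂.2.2) ^ 2 ≤ 0) : dimH S ≤ 2 := by
  -- With x = Δq and p = 2Δ(σ - q) + ex, the cone condition reads -xp ≤ K(ΔR)², and the first
  -- component of F changes by p + x. So x² + p² ≤ (p + x)² + 2K(ΔR)² is controlled by F.
  set F : ℝ × ℝ × ℝ → ℝ × ℝ := fun y => (2 * y.2.1 + (e - 1) * y.1, y.2.2) with hF
  refine (dimH_le_dimH_image_of_dist_le (f := F)
    (K := (2 + |e|) * (2 + 2 * |K|)) fun y₁ h₁ y₂ h₂ => ?_).trans (dimH_plane_le _)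
  have hc := h y₁ h₁ y₂ h₂
  obtain ⟨q₁, σ₁, r₁⟩ := y₁
  obtain ⟨q₂, σ₂, r₂⟩ := y₂
  simp only [hF, Prod.dist_eq, Real.dist_eq] at hc ⊢
  set D := max |2 * σ₁ + (e - 1) * q₁ - (2 * σ₂ + (e - 1) * q₂)| |r₁ - r₂|
  have hD0 : 0 ≤ D := (abs_nonneg _).trans (le_max_right _ _)
  have hr : |r₁ - r₂| ≤ D := le_max_right _ _
  have hp : |2 * σ₁ + (e - 1) * q₁ - (2 * σ₂ + (e - 1) * q₂)| ≤ D := le_max_left _ _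
  have hr2 : (r₁ - r₂) ^ 2 ≤ D ^ 2 := by rw [← sq_abs]; gcongr
  have hp2 : (2 * σ₁ + (e - 1) * q₁ - (2 * σ₂ + (e - 1) * q₂)) ^ 2 ≤ D ^ 2 := by
    rw [← sq_abs]; gcongr
  have hK := abs_nonneg K
  have he := abs_nonneg e
  have hKr : K * (r₁ - r₂) ^ 2 ≤ |K| * D ^ 2 :=
    (mul_le_mul_of_nonneg_right (le_abs_self K) (sq_nonneg _)).trans (by gcongr)
  have hsum : (q₁ - q₂) ^ 2 + (2 * (σ₁ - σ₂ - (q₁ - q₂)) + e * (q₁ - q₂)) ^ 2 ≤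
      ((2 + 2 * |K|) * D) ^ 2 := by
    nlinarith [mul_nonneg hK (sq_nonneg D), mul_nonneg (mul_nonneg hK hK) (sq_nonneg D)]
  have hM : 0 ≤ (2 + 2 * |K|) * D := by positivity
  have hx : |q₁ - q₂| ≤ (2 + 2 * |K|) * D :=
    abs_le_of_sq_le_sq (by nlinarith [sq_nonneg (2 * (σ₁ - σ₂ - (q₁ - q₂)) + e * (q₁ - q₂))]) hM
  have hy : |2 * (σ₁ - σ₂ - (q₁ - q₂)) + e * (q₁ - q₂)| ≤ (2 + 2 * |K|) * D :=
    abs_le_of_sq_le_sq (by nlinarith [sq_nonneg (q₁ - q₂)]) hM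
  have hσ : |σ₁ - σ₂| ≤ (2 + |e|) * (2 + 2 * |K|) * D := by
    have h1 : σ₁ - σ₂ = (2 * (σ₁ - σ₂ - (q₁ - q₂)) + e * (q₁ - q₂)) / 2 + (q₁ - q₂)
        + -(e * (q₁ - q₂)) / 2 := by ring
    have h2 := abs_add_three ((2 * (σ₁ - σ₂ - (q₁ - q₂)) + e * (q₁ - q₂)) / 2) (q₁ - q₂)
      (-(e * (q₁ - q₂)) / 2)
    rw [← h1, abs_div, abs_div, abs_neg, abs_mul, abs_two] at h2
    nlinarith [mul_le_mul_of_nonneg_left hx he, mul_nonneg he hM]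
  refine max_le ?_ (max_le hσ ?_)
  · nlinarith [mul_nonneg he hM]
  · nlinarith [mul_nonneg he hM]

end Cone

/-! ### Collision orbits as orbits near a saddle. -/

section StableSet

open Set

variable {P : Params} {C h L : ℝ} {γ : ℝ → Phase} {T : ℝ} {x : Phase}

/-- The coordinates `(z / R, dz / dR, R)` of a point of the phase space. -/
noncomputable def shapeCoords (P : Params) (x : Phase) : ℝ × ℝ × ℝ :=
  (x 1 / x 0, slope P x, x 0)

/-- The derivative of the slope `dz / dR` with respect to `-log R`, on the energy level `h`. -/
noncomputable def slopeField (P : Params) (C h : ℝ) (y : ℝ × ℝ × ℝ) : ℝ :=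
  (y.2.1 * (force₁ P C y.1 y.2.2 / T₁ P) - force₂ P y.1 y.2.2 / T₂ P) *
    ((T₁ P + T₂ P * y.2.1 ^ 2) / (2 * kinetic P C h y.1 y.2.2))

@[fun_prop]
theorem contDiff_shapeRho_comp {E : Type*} [NormedAddCommGroup E] [NormedSpace ℝ E] {f : E → ℝ}
    {y : E} (hf : ContDiffAt ℝ 1 f y) : ContDiffAt ℝ 1 (fun y => shapeRho (f y)) y :=
  contDiff_shapeRho.contDiffAt.comp y hf

theorem contDiffAt_kinetic (y : ℝ × ℝ × ℝ) :
    ContDiffAt ℝ 1 (fun y : ℝ × ℝ × ℝ => kinetic P C h y.1 y.2.2) y := by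
  have := (shapeRho_pos y.1).ne'
  have h3 := pow_ne_zero 3 this
  unfold kinetic
  fun_prop (disch := assumption)

theorem contDiffAt_slopeField {y : ℝ × ℝ × ℝ} (hy : kinetic P C h y.1 y.2.2 ≠ 0) :
    ContDiffAt ℝ 1 (slopeField P C h) y := by
  have := (shapeRho_pos y.1).ne'
  have h3 := pow_ne_zero 3 this
  have h5 := pow_ne_zero 5 this
  have hk := mul_ne_zero two_ne_zero hy
  have := contDiffAt_kinetic (P := P) (C := C) (h := h) y
  unfold slopeField force₁ force₂
  fun_prop (disch := assumption)

/-- For R = 0 and σ = q the field is q times a positive function times an increasing function of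
ρ⁻⁵. The last factor vanishes at L, so only its derivative contributes; times L it is negative
because ρ grows with |q|. -/
theorem hasDerivAt_slopeField_diag
    (hL : L ≠ 0) (hρ : P.B * shapeRho L ^ 5 = 16 * P.B₁ * (mu P - 1)) :
    ∃ k < 0, HasDerivAt (fun q => slopeField P C h (q, q, 0)) k L := by
  have hT₁ := T₁_pos P
  have hT₂ := T₂_pos P
  have hB₁ := P.B₁_pos
  have hμ1 := mu_sub_one_pos P
  have hρ0 := shapeRho_pos L
  have hk := kinetic_zero_pos P C h L
  have hμ : mu P = 4 * T₁ P / T₂ P := by rw [eq_div_iff hT₂.ne', mu_mul_T₂]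
  set g : ℝ → ℝ := fun q => (T₁ P + T₂ P * q ^ 2) / (2 * kinetic P C h q 0) with hg
  have hform : (fun q => slopeField P C h (q, q, 0)) =
      fun q => q * g q * (3 / T₁ P * (16 * P.B₁ * (mu P - 1) * (shapeRho q ^ 5)⁻¹ - P.B)) := by
    funext q
    have := shapeRho_pos q
    have hkq := kinetic_zero_pos P C h q
    simp only [slopeField, hg, force₁, force₂, hμ]
    field_simp
    ring
  have hgd : DifferentiableAt ℝ g L := by
    have h1 : ContDiffAt ℝ 1 (fun q : ℝ => kinetic P C h q 0) L :=
      (contDiffAt_kinetic (P := P) (C := C) (h := h) (L, L, 0)).comp L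
        (f := fun q : ℝ => (q, q, (0 : ℝ))) (by fun_prop)
    have h2 := h1.differentiableAt one_ne_zero
    have h3 : 2 * kinetic P C h L 0 ≠ 0 := by positivity
    rw [hg]
    fun_prop (disch := assumption)
  have hgpos : 0 < g L := by simp only [hg]; positivity
  have h1 := (((((hasDerivAt_shapeRho L).pow 5).inv (pow_pos hρ0 5).ne').const_mul
    (16 * P.B₁ * (mu P - 1))).sub_const P.B).const_mul (3 / T₁ P)
  have h2 := ((hasDerivAt_id L).mul hgd.hasDerivAt).mul h1
  rw [hform]
  refine ⟨_, ?_, h2⟩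
  have h3 : 16 * P.B₁ * (mu P - 1) * (shapeRho L ^ 5)⁻¹ - P.B = 0 := by
    rw [← hρ]; field_simp; ring
  simp only [Pi.inv_apply, Pi.pow_apply, Pi.mul_apply, h3, mul_zero, zero_add, id]
  have hL2 : 0 < L ^ 2 := by positivity
  have h4 : L * g L * (3 / T₁ P * (16 * P.B₁ * (mu P - 1) *
      (-(((5 : ℕ) : ℝ) * shapeRho L ^ (5 - 1) * (4 * L / shapeRho L)) / (shapeRho L ^ 5) ^ 2))) =
      -(g L * (3 / T₁ P * (16 * P.B₁ * (mu P - 1) *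
        (20 * shapeRho L ^ 4 * (L ^ 2 / shapeRho L) / (shapeRho L ^ 5) ^ 2)))) := by
    push_cast
    ring
  rw [h4]
  exact neg_neg_of_pos (by positivity)

theorem exists_fderiv_slopeField
    (hL : L ≠ 0) (hρ : P.B * shapeRho L ^ 5 = 16 * P.B₁ * (mu P - 1)) :
    ∃ A : ℝ × ℝ × ℝ →L[ℝ] ℝ, HasStrictFDerivAt (slopeField P C h) A (L, L, 0) ∧
      A (1, 1, 0) < 0 := by
  have h1 := (contDiffAt_slopeField (P := P) (C := C) (h := h) (y := (L, L, 0))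
    (kinetic_zero_pos P C h L).ne').hasStrictFDerivAt one_ne_zero
  refine ⟨_, h1, ?_⟩
  obtain ⟨k, hk, h2⟩ := hasDerivAt_slopeField_diag (C := C) (h := h) hL hρ
  have h3 : HasDerivAt (fun q : ℝ => (q, q, (0 : ℝ))) (1, 1, 0) L :=
    (hasDerivAt_id L).prodMk ((hasDerivAt_id L).prodMk (hasDerivAt_const L 0))
  have h4 := h1.hasFDerivAt.comp_hasDerivAt L h3
  rwa [h4.unique h2]

theorem tendsto_shapeCoords (hT : 0 < T) (hγ : IsSolutionOn P C γ (Ico 0 T))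
    (hR : Tendsto (fun t => γ t 0) (𝓝[<] T) (𝓝 0))
    (hz : Tendsto (fun t => γ t 1) (𝓝[<] T) (𝓝 0))
    (hq : Tendsto (fun t => γ t 1 / γ t 0) (𝓝[<] T) (𝓝 L)) :
    Tendsto (fun t => shapeCoords P (γ t)) (𝓝[<] T) (𝓝 (L, L, 0)) :=
  hq.prodMk_nhds ((tendsto_slope hT hγ hR hz hq).2.prodMk_nhds hR)

/-- A solution with `dR/dt < 0` that tends to triple collision, as a function of `-log R`. -/
theorem exists_shapeOrbit {t₀ t : ℝ} (ht₀ : 0 ≤ t₀) (ht : t ∈ Ioo t₀ T)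
    (hγ : IsSolutionOn P C γ (Ico 0 T)) (hh : hamiltonian P C (γ 0) = h)
    (hneg : ∀ s ∈ Ioo t₀ T, γ s 2 < 0)
    (hR : Tendsto (fun t => γ t 0) (𝓝[<] T) (𝓝 0)) :
    ∃ τ : ℝ → ℝ, τ 0 = t ∧ (∀ s, 0 ≤ s → τ s ∈ Ico t T) ∧ Tendsto τ atTop (𝓝[<] T) ∧
      IsShapeOrbit (slopeField P C h) (fun s => shapeCoords P (γ (τ s))) := by
  have hT₁ := T₁_pos P
  have hT₂ := T₂_pos P
  have hnhds : ∀ s ∈ Ioo t₀ T, Ico 0 T ∈ 𝓝 s := fun s hs =>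
    Ico_mem_nhds (ht₀.trans_lt hs.1) hs.2
  have hpos : ∀ s ∈ Ioo t₀ T, 0 < γ s 0 := fun s hs => (hγ s (mem_of_mem_nhds (hnhds s hs))).1
  obtain ⟨τ, hτ0, hτ, hτT⟩ := exists_time_change (f := fun s => -Real.log (γ s 0))
    (f' := fun s => -(γ s 2 / T₁ P / γ s 0))
    (fun s hs => ((hγ.hasDerivAt_zero (hnhds s hs)).log (hpos s hs).ne').neg)
    (fun s hs => neg_pos.2 (div_neg_of_neg_of_pos (div_neg_of_neg_of_pos (hneg s hs) hT₁)
      (hpos s hs)))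
    (tendsto_neg_atBot_atTop.comp (Real.tendsto_log_nhdsGT_zero.comp
      (tendsto_nhdsWithin_iff.2 ⟨hR, by
        filter_upwards [Ioo_mem_nhdsLT (ht.1.trans ht.2)] with s hs using hpos s hs⟩))) ht
  refine ⟨τ, hτ0, fun s hs => (hτ s hs).1, hτT, fun s hs => ?_⟩
  obtain ⟨hmem, -, hder⟩ := hτ s hs
  have hm : τ s ∈ Ioo t₀ T := ⟨ht.1.trans_le hmem.1, hmem.2⟩
  have hn := hnhds _ hm
  have h0 := hpos _ hm
  have h2 := hneg _ hm
  have h2' : γ (τ s) 2 ≠ 0 := h2.ne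
  have hv : γ (τ s) 2 / T₁ P < 0 := div_neg_of_neg_of_pos h2 hT₁
  have d0 := (hγ.hasDerivAt_zero hn).comp s hder
  have d1 := (hγ.hasDerivAt_one hn).comp s hder
  have d2 := (hγ.hasDerivAt_two hn).comp s hder
  have d3 := (hγ.hasDerivAt_three hn).comp s hder
  have hE := (hγ.hamiltonian_eq (mem_of_mem_nhds hn)).trans hh
  have hkin := kinetic_eq_of_hamiltonian_eq h0 hE
  refine ⟨(d1.div d0 h0.ne').congr_deriv ?_,
    ((d3.div_const (T₂ P)).div (d2.div_const (T₁ P)) hv.ne).congr_deriv ?_, d0.congr_deriv ?_⟩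
  · simp only [shapeCoords, slope, Function.comp_apply]
    field_simp
    ring
  · simp only [shapeCoords, slope, slopeField, Function.comp_apply]
    -- The energy integral turns `kinetic` back into momenta, whose powers cancel those from the
    -- change of time.
    rw [hkin]
    generalize force₁ P C (γ (τ s) 1 / γ (τ s) 0) (γ (τ s) 0) = F₁
    generalize force₂ P (γ (τ s) 1 / γ (τ s) 0) (γ (τ s) 0) = F₂
    have : 0 < γ (τ s) 2 ^ 2 := by positivity
    have : T₂ P * γ (τ s) 2 ^ 2 + T₁ P * γ (τ s) 3 ^ 2 ≠ 0 := by positivity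
    field_simp
    ring
  · simp only [shapeCoords]
    field_simp

/-- The inverse of `shapeCoords` on the part `P_R < 0` of the energy level `h`. -/
noncomputable def ofShapeCoords (P : Params) (C h : ℝ) (y : ℝ × ℝ × ℝ) : Phase :=
  !₂[y.2.2, y.1 * y.2.2,
    -T₁ P * √(2 * kinetic P C h y.1 y.2.2 / (y.2.2 ^ 3 * (T₁ P + T₂ P * y.2.1 ^ 2))),
    -T₂ P * y.2.1 *
      √(2 * kinetic P C h y.1 y.2.2 / (y.2.2 ^ 3 * (T₁ P + T₂ P * y.2.1 ^ 2)))]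

theorem ofShapeCoords_shapeCoords (hx : 0 < x 0) (hp : x 2 < 0) (hh : hamiltonian P C x = h) :
    ofShapeCoords P C h (shapeCoords P x) = x := by
  have hT₁ := T₁_pos P
  have hT₂ := T₂_pos P
  have hv : x 2 / T₁ P < 0 := div_neg_of_neg_of_pos hp hT₁
  have h1 : √(2 * kinetic P C h (x 1 / x 0) (x 0) /
      (x 0 ^ 3 * (T₁ P + T₂ P * slope P x ^ 2))) = -(x 2 / T₁ P) := by
    rw [Real.sqrt_eq_iff_mul_self_eq_of_pos (neg_pos.2 hv), kinetic_eq_of_hamiltonian_eq hx hh,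
      three_eq (P := P) hp.ne]
    field_simp
  ext i
  fin_cases i
  · rfl
  · exact div_mul_cancel₀ _ hx.ne'
  · change -T₁ P * √(2 * kinetic P C h (x 1 / x 0) (x 0) /
      (x 0 ^ 3 * (T₁ P + T₂ P * slope P x ^ 2))) = x 2
    rw [h1]; field_simp
  · change -T₂ P * slope P x * √(2 * kinetic P C h (x 1 / x 0) (x 0) /
      (x 0 ^ 3 * (T₁ P + T₂ P * slope P x ^ 2))) = x 3
    rw [h1, three_eq (P := P) hp.ne]; ring

theorem contDiffAt_ofShapeCoords {y : ℝ × ℝ × ℝ} (hy : 0 < y.2.2)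
    (hk : 0 < kinetic P C h y.1 y.2.2) : ContDiffAt ℝ 1 (ofShapeCoords P C h) y := by
  have hT₁ := T₁_pos P
  have hT₂ := T₂_pos P
  have h1 := contDiffAt_kinetic (P := P) (C := C) (h := h) y
  have h2 : y.2.2 ^ 3 * (T₁ P + T₂ P * y.2.1 ^ 2) ≠ 0 := by positivity
  have h3 : 2 * kinetic P C h y.1 y.2.2 / (y.2.2 ^ 3 * (T₁ P + T₂ P * y.2.1 ^ 2)) ≠ 0 := by
    positivity
  have h4 : ContDiffAt ℝ 1 (fun y : ℝ × ℝ × ℝ =>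
      √(2 * kinetic P C h y.1 y.2.2 / (y.2.2 ^ 3 * (T₁ P + T₂ P * y.2.1 ^ 2)))) y := by
    refine ContDiffAt.sqrt ?_ h3
    fun_prop (disch := assumption)
  rw [contDiffAt_piLp]
  intro i
  fin_cases i <;> simp [ofShapeCoords] <;> fun_prop

theorem contDiffAt_vectorField (hx : 0 < x 0) : ContDiffAt ℝ 1 (vectorField P C) x := by
  have hM := P.M_pos
  have h0 : ∀ i : Fin 4, ContDiffAt ℝ 1 (fun x : Phase => x i) x := fun i =>
    (EuclideanSpace.proj (𝕜 := ℝ) i).contDiff.contDiffAt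
  have h1 : 0 < x 0 ^ 2 + 4 * x 1 ^ 2 := by positivity
  have h2 : ContDiffAt ℝ 1 (fun x : Phase => √(x 0 ^ 2 + 4 * x 1 ^ 2)) x := by
    refine ContDiffAt.sqrt ?_ h1.ne'
    exact ((h0 0).pow 2).add (contDiffAt_const.mul ((h0 1).pow 2))
  have h3 := Real.sqrt_pos.2 h1
  have e1 := (pow_pos h3 3).ne'
  have e2 := (pow_pos h3 5).ne'
  have e3 := (pow_pos hx 2).ne'
  have e4 := (pow_pos hx 4).ne'
  have e5 : P.M * x 0 ^ 3 ≠ 0 := by positivity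
  have hz := h0 0
  have ho := h0 1
  have ht := h0 2
  have hth := h0 3
  rw [contDiffAt_piLp]
  intro i
  fin_cases i <;> simp [vectorField] <;> fun_prop (disch := assumption)

end StableSet

/-! ### Dimension and measure of the collision set. -/

section Measure

open Set
open scoped NNReal ENNReal

variable {P : Params} {C h L : ℝ} {γ : ℝ → Phase} {T : ℝ} {x : Phase}

/-- A compact exhaustion of the phase space. -/
def phaseCompact (n : ℕ) : Set Phase := {x | 1 ≤ (n + 1 : ℝ) * x 0} ∩ Metric.closedBall 0 n

theorem pos_of_mem_phaseCompact {n : ℕ} (hx : x ∈ phaseCompact n) : 0 < x 0 := by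
  have h1 : 1 ≤ (n + 1 : ℝ) * x 0 := hx.1
  have h2 : (0 : ℝ) < n + 1 := by positivity
  by_contra h3
  nlinarith

theorem isCompact_phaseCompact (n : ℕ) : IsCompact (phaseCompact n) := by
  refine (isCompact_closedBall (0 : Phase) n).inter_left ?_
  have : Continuous fun x : Phase => x 0 := (EuclideanSpace.proj (𝕜 := ℝ) (0 : Fin 4)).continuous
  exact isClosed_le continuous_const (continuous_const.mul this)

theorem exists_phaseCompact {K : Set Phase} (hK : IsCompact K) (hpos : ∀ x ∈ K, 0 < x 0) :
    ∃ n, K ⊆ phaseCompact n := by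
  have hcont : Continuous fun x : Phase => x 0 :=
    (EuclideanSpace.proj (𝕜 := ℝ) (0 : Fin 4)).continuous
  obtain ⟨B, hB⟩ := hK.isBounded.exists_norm_le
  obtain ⟨δ, hδ0, hδ⟩ : ∃ δ > 0, ∀ x ∈ K, δ ≤ x 0 := by
    rcases K.eq_empty_or_nonempty with rfl | hne
    · exact ⟨1, one_pos, by simp⟩
    · obtain ⟨y, hy, hmin⟩ := hK.exists_isMinOn hne hcont.continuousOn
      exact ⟨y 0, hpos y hy, fun x hx => hmin hx⟩
  obtain ⟨n, hn⟩ := exists_nat_ge (max B δ⁻¹)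
  refine ⟨n, fun x hx => ⟨?_, ?_⟩⟩
  · have h1 : δ⁻¹ ≤ n := (le_max_right _ _).trans hn
    have h2 := hδ x hx
    rw [inv_le_iff_one_le_mul₀ hδ0] at h1
    change 1 ≤ (n + 1 : ℝ) * x 0
    nlinarith [(Nat.cast_nonneg n : (0 : ℝ) ≤ n)]
  · rw [mem_closedBall_zero_iff]
    exact (hB x hx).trans ((le_max_left _ _).trans hn)

/-- Solutions that stay in a compact set up to time `t` depend Lipschitz continuously on their
positions at time `t`. -/
theorem exists_dist_le_mul_dist (P : Params) (C : ℝ) (n : ℕ) (t : ℝ) : ∃ K : ℝ,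
    ∀ (T₁ T₂ : ℝ) (γ₁ γ₂ : ℝ → Phase), t ∈ Ioo 0 T₁ → t ∈ Ioo 0 T₂ →
      IsSolutionOn P C γ₁ (Ico 0 T₁) → IsSolutionOn P C γ₂ (Ico 0 T₂) →
      (∀ s ∈ Icc 0 t, γ₁ s ∈ phaseCompact n) → (∀ s ∈ Icc 0 t, γ₂ s ∈ phaseCompact n) →
      dist (γ₁ 0) (γ₂ 0) ≤ K * dist (γ₁ t) (γ₂ t) := by
  have hloc : LocallyLipschitzOn (phaseCompact n) (fun x => -vectorField P C x) := by
    intro x hx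
    obtain ⟨K, s, hs, hK⟩ :=
      (contDiffAt_vectorField (P := P) (C := C) (pos_of_mem_phaseCompact hx)).neg
        |>.exists_lipschitzOnWith
    exact ⟨K, s, mem_nhdsWithin_of_mem_nhds hs, hK⟩
  obtain ⟨K, hK⟩ := hloc.exists_lipschitzOnWith_of_compact (isCompact_phaseCompact n)
  refine ⟨Real.exp (K * t), fun T₁ T₂ γ₁ γ₂ ht₁ ht₂ h₁ h₂ hm₁ hm₂ => ?_⟩
  have ht0 := ht₁.1
  -- Time is reversed so that Grönwall's inequality bounds the initial distance by the distance at
  -- time t.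
  have hrev : ∀ {T : ℝ} {γ : ℝ → Phase}, t ∈ Ioo 0 T → IsSolutionOn P C γ (Ico 0 T) →
      ContinuousOn (fun s => γ (t - s)) (Icc 0 t) ∧ ∀ s ∈ Ico 0 t,
        HasDerivWithinAt (fun s => γ (t - s)) (-vectorField P C (γ (t - s))) (Ici s) s := by
    intro T γ ht hγ
    constructor
    · have hc : ContinuousOn γ (Ico 0 T) := fun s hs => (hγ s hs).2.continuousWithinAt
      exact hc.comp (by fun_prop) fun s hs =>
        ⟨by linarith [hs.2], by linarith [hs.1, ht.2]⟩
    · intro s hs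
      have hn : Ico 0 T ∈ 𝓝 (t - s) :=
        Ico_mem_nhds (by linarith [hs.2]) (by linarith [hs.1, ht.2])
      exact ((hγ.hasDerivAt hn).comp_const_sub t s).hasDerivWithinAt
  have hmem : ∀ s ∈ Ico 0 t, t - s ∈ Icc 0 t := fun s hs =>
    ⟨by linarith [hs.2], by linarith [hs.1]⟩
  have := dist_le_of_trajectories_ODE_of_mem (v := fun _ x => -vectorField P C x)
    (s := fun _ => phaseCompact n) (a := 0) (b := t) (K := K) (fun _ _ => hK)
    (hrev ht₁ h₁).1 (hrev ht₁ h₁).2 (fun s hs => hm₁ _ (hmem s hs))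
    (hrev ht₂ h₂).1 (hrev ht₂ h₂).2 (fun s hs => hm₂ _ (hmem s hs)) le_rfl t ⟨ht0.le, le_rfl⟩
  simp only [sub_self, sub_zero] at this
  linarith

/-- The points of the energy level `h` whose solution is at time `t` on its way to triple collision
at shape `L`, with shape coordinates that remain in `U`, after having stayed in a compact set. -/
def localCollisionSet (P : Params) (C h L : ℝ) (U : Set (ℝ × ℝ × ℝ)) (n : ℕ) (t : ℝ) :
    Set Phase :=
  {x | hamiltonian P C x = h ∧ ∃ (T t₀ : ℝ) (γ : ℝ → Phase), 0 ≤ t₀ ∧ t ∈ Ioo t₀ T ∧ γ 0 = x ∧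
    IsSolutionOn P C γ (Ico 0 T) ∧ (∀ s ∈ Ioo t₀ T, γ s 2 < 0) ∧
    (∀ s ∈ Ioo t₀ T, shapeCoords P (γ s) ∈ U) ∧
    Tendsto (fun s => γ s 0) (𝓝[<] T) (𝓝 0) ∧
    Tendsto (fun s => shapeCoords P (γ s)) (𝓝[<] T) (𝓝 (L, L, 0)) ∧
    ∀ s ∈ Icc 0 t, γ s ∈ phaseCompact n}

/-- The cone condition holds for the shape coordinates at time t. The energy and P_R < 0 recover the
phase point from them in a locally Lipschitz way, and the backward flow returns Lipschitz
continuously to time 0. -/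
theorem dimH_localCollisionSet_le {U : Set (ℝ × ℝ × ℝ)} {e K : ℝ}
    (hU : ∀ y₁ y₂ : ℝ → ℝ × ℝ × ℝ, IsShapeOrbit (slopeField P C h) y₁ →
      IsShapeOrbit (slopeField P C h) y₂ →
      (∀ s, 0 ≤ s → y₁ s ∈ U) → (∀ s, 0 ≤ s → y₂ s ∈ U) →
      Tendsto y₁ atTop (𝓝 (L, L, 0)) → Tendsto y₂ atTop (𝓝 (L, L, 0)) →
      -2 * ((y₁ 0).1 - (y₂ 0).1) * (((y₁ 0).2.1 - (y₂ 0).2.1) - ((y₁ 0).1 - (y₂ 0).1))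
        - e * ((y₁ 0).1 - (y₂ 0).1) ^ 2 - K * ((y₁ 0).2.2 - (y₂ 0).2.2) ^ 2 ≤ 0)
    (n : ℕ) (t : ℝ) : dimH (localCollisionSet P C h L U n t) ≤ 2 := by
  set D := localCollisionSet P C h L U n t
  have hex : ∀ x ∈ D, hamiltonian P C x = h ∧ ∃ (T t₀ : ℝ) (γ : ℝ → Phase), 0 ≤ t₀ ∧
    t ∈ Ioo t₀ T ∧ γ 0 = x ∧
    IsSolutionOn P C γ (Ico 0 T) ∧ (∀ s ∈ Ioo t₀ T, γ s 2 < 0) ∧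
    (∀ s ∈ Ioo t₀ T, shapeCoords P (γ s) ∈ U) ∧
    Tendsto (fun s => γ s 0) (𝓝[<] T) (𝓝 0) ∧
    Tendsto (fun s => shapeCoords P (γ s)) (𝓝[<] T) (𝓝 (L, L, 0)) ∧
    ∀ s ∈ Icc 0 t, γ s ∈ phaseCompact n := fun x hx => hx
  choose! hen T t₀ γ ht₀ ht hγ0 hγ hneg hmem hR hlim hcpt using hex
  set g : Phase → Phase := fun x => γ x t with hg
  have h0t : ∀ x ∈ D, t ∈ Ioo 0 (T x) := fun x hx => ⟨(ht₀ x hx).trans_lt (ht x hx).1, (ht x hx).2⟩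
  have hbase : ∀ x ∈ D, 0 < g x 0 ∧ g x 2 < 0 ∧ hamiltonian P C (g x) = h := by
    intro x hx
    have h1 : t ∈ Ico 0 (T x) := ⟨(h0t x hx).1.le, (h0t x hx).2⟩
    refine ⟨(hγ x hx t h1).1, hneg x hx t (ht x hx), ?_⟩
    rw [hg, (hγ x hx).hamiltonian_eq h1, hγ0 x hx, hen x hx]
  obtain ⟨M, hM⟩ := exists_dist_le_mul_dist P C n t
  calc dimH D ≤ dimH (g '' D) := by
        refine dimH_le_dimH_image_of_dist_le (K := M) fun x hx y hy => ?_
        have := hM (T x) (T y) (γ x) (γ y) (h0t x hx) (h0t y hy) (hγ x hx) (hγ y hy)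
          (hcpt x hx) (hcpt y hy)
        rwa [hγ0 x hx, hγ0 y hy] at this
    _ = dimH (ofShapeCoords P C h '' (shapeCoords P '' (g '' D))) := by
        congr 1
        rw [← image_comp, ← image_comp]
        refine image_congr fun x hx => ?_
        obtain ⟨h1, h2, h3⟩ := hbase x hx
        exact (ofShapeCoords_shapeCoords h1 h2 h3).symm
    _ ≤ dimH (shapeCoords P '' (g '' D)) := by
        refine dimH_image_le_of_locally_lipschitzOn ?_
        rintro _ ⟨_, ⟨x, hx, rfl⟩, rfl⟩
        obtain ⟨h1, h2, h3⟩ := hbase x hx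
        have hk : 0 < kinetic P C h (g x 1 / g x 0) (g x 0) := by
          have := T₁_pos P
          have := T₂_pos P
          have : 0 < g x 2 ^ 2 := by have := h2.ne; positivity
          rw [kinetic_eq_of_hamiltonian_eq h1 h3]
          positivity
        obtain ⟨N, s, hs, hN⟩ := (contDiffAt_ofShapeCoords (P := P) (C := C) (h := h)
          (y := shapeCoords P (g x)) h1 hk).exists_lipschitzOnWith
        exact ⟨N, s, mem_nhdsWithin_of_mem_nhds hs, hN⟩
    _ ≤ 2 := by
        have horb : ∀ x ∈ D, ∃ y : ℝ → ℝ × ℝ × ℝ, y 0 = shapeCoords P (g x) ∧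
            IsShapeOrbit (slopeField P C h) y ∧ (∀ s, 0 ≤ s → y s ∈ U) ∧
            Tendsto y atTop (𝓝 (L, L, 0)) := by
          intro x hx
          obtain ⟨τ, hτ0, hτ, hτT, horb⟩ := exists_shapeOrbit (ht₀ x hx) (ht x hx) (hγ x hx)
            ((congrArg _ (hγ0 x hx)).trans (hen x hx)) (hneg x hx) (hR x hx)
          refine ⟨_, by simp only [hτ0, hg], horb, fun s hs => ?_, (hlim x hx).comp hτT⟩
          exact hmem x hx _ ⟨(ht x hx).1.trans_le (hτ s hs).1, (hτ s hs).2⟩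
        refine dimH_le_two_of_cone (e := e) (K := K) ?_
        rintro _ ⟨_, ⟨x₁, hx₁, rfl⟩, rfl⟩ _ ⟨_, ⟨x₂, hx₂, rfl⟩, rfl⟩
        obtain ⟨y₁, hy₁, ho₁, hU₁, hl₁⟩ := horb x₁ hx₁
        obtain ⟨y₂, hy₂, ho₂, hU₂, hl₂⟩ := horb x₂ hx₂
        have := hU y₁ y₂ ho₁ ho₂ hU₁ hU₂ hl₁ hl₂
        rwa [hy₁, hy₂] at this

theorem dimH_tripleCollisionWithShape_le (hL : L ≠ 0) :
    dimH {x | x ∈ energyLevel P C h ∧ TripleCollisionWithShape P C x L} ≤ 2 := by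
  by_cases hρ : P.B * shapeRho L ^ 5 = 16 * P.B₁ * (mu P - 1)
  · obtain ⟨A, hA, hA0⟩ := exists_fderiv_slopeField (C := C) (h := h) hL hρ
    obtain ⟨U, hU, e, K, hcone⟩ := exists_cone hA hA0
    have hsub : {x | x ∈ energyLevel P C h ∧ TripleCollisionWithShape P C x L} ⊆
        ⋃ p : ℕ × ℚ, localCollisionSet P C h L U p.1 p.2 := by
      rintro x ⟨⟨-, hen⟩, T, γ, hT, hγ0, hγ, hR, hz, hq⟩
      have hlim := tendsto_shapeCoords hT hγ hR hz hq
      obtain ⟨t₀, ht₀, hev⟩ := eventually_nhdsLT_iff_Ioo.1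
        ((eventually_momentum_neg hT hγ hR hq).and (hlim.eventually_mem hU))
      -- A rational observation time keeps the union countable.
      obtain ⟨t, ht1, ht2⟩ := exists_rat_btwn (max_lt ht₀ hT)
      obtain ⟨n, hn⟩ := exists_phaseCompact (K := γ '' Icc 0 (t : ℝ))
        (isCompact_Icc.image_of_continuousOn fun s hs =>
          ((hγ s ⟨hs.1, hs.2.trans_lt ht2⟩).2.continuousWithinAt).mono
            fun r hr => ⟨hr.1, hr.2.trans_lt ht2⟩)
        (by rintro _ ⟨s, hs, rfl⟩; exact (hγ s ⟨hs.1, hs.2.trans_lt ht2⟩).1)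
      refine mem_iUnion.2 ⟨(n, t), hen, T, max t₀ 0, γ, le_max_right _ _, ⟨ht1, ht2⟩, hγ0, hγ,
        fun s hs => (hev s ⟨(le_max_left _ _).trans_lt hs.1, hs.2⟩).1,
        fun s hs => (hev s ⟨(le_max_left _ _).trans_lt hs.1, hs.2⟩).2, hR, hlim,
        fun s hs => hn (mem_image_of_mem γ hs)⟩
    refine (dimH_mono hsub).trans ?_
    rw [dimH_iUnion]
    exact iSup_le fun p => dimH_localCollisionSet_le hcone p.1 p.2
  · have : {x | x ∈ energyLevel P C h ∧ TripleCollisionWithShape P C x L} = ∅ := by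
      ext x
      simp only [mem_ofPred_eq, mem_empty_iff_false, iff_false]
      rintro ⟨-, T, γ, hT, -, hγ, hR, hz, hq⟩
      exact hρ (shapeRho_limit hT hγ hL hR hz hq)
    rw [this, dimH_empty]
    exact zero_le

/-- Only the two shapes given by ±θ_w can occur, so the union over L is finite. -/
theorem dimH_triangularTripleCollision_le :
    dimH {x | x ∈ energyLevel P C h ∧ TriangularTripleCollision P C x} ≤ 2 := by
  set L₀ := √(T₁ P) / √(T₂ P) * Real.tan (thetaW P) with hL₀
  have hsub : {x | x ∈ energyLevel P C h ∧ TriangularTripleCollision P C x} ⊆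
      ⋃ L ∈ ({L₀, -L₀} \ {0} : Set ℝ),
        {x | x ∈ energyLevel P C h ∧ TripleCollisionWithShape P C x L} := by
    rintro x ⟨hx, L, hL, hcol⟩
    obtain ⟨T, γ, hT, -, hγ, hR, hz, hq⟩ := id hcol
    refine mem_biUnion (x := L) ⟨?_, hL⟩ ⟨hx, hcol⟩
    rw [shape_eq_tan P L]
    rcases shapeAngle_eq_or (shapeRho_limit hT hγ hL hR hz hq) with hθ | hθ
    · left
      rw [hθ]
    · right
      rw [hθ, Real.tan_neg, mul_neg]
      rfl
  refine (dimH_mono hsub).trans ?_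
  rw [dimH_bUnion (((countable_singleton _).insert _).mono sdiff_subset)]
  exact iSup₂_le fun L hL => dimH_tripleCollisionWithShape_le hL.2

theorem hausdorffMeasure_triangularTripleCollision (P : Params) (C h : ℝ) :
    MeasureTheory.Measure.hausdorffMeasure 3
      {x : Phase | x ∈ energyLevel P C h ∧ TriangularTripleCollision P C x} = 0 := by
  have h1 : dimH {x | x ∈ energyLevel P C h ∧ TriangularTripleCollision P C x} <
      ((3 : ℝ≥0) : ℝ≥0∞) := dimH_triangularTripleCollision_le.trans_lt (by norm_num)
  have h2 := hausdorffMeasure_of_dimH_lt h1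
  rwa [NNReal.coe_ofNat] at h2

end Measure

end IsoscelesSchwarzschild

theorem mainTheorem5 (P : Params)
    (hμA : 1 + P.A / (4 * P.A₁) < mu P)
    (hμB : 1 + P.B / (16 * P.B₁) < mu P)
    (hgen : (mu P - 1) ^ (4 / 15 : ℝ) * (4 * P.A₁ / P.A) ^ (2 / 3 : ℝ)
      ≠ (16 * P.B₁ / P.B) ^ (2 / 5 : ℝ)) :
    -- on every energy level, the set is null for the three-dimensional surface measure
    (∀ C h : ℝ, MeasureTheory.Measure.hausdorffMeasure 3
      {x : Phase | x ∈ energyLevel P C h ∧ TriangularTripleCollision P C x} = 0) ∧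
    -- the orbits concerned are those that tend to one of the two equilibria
    (∀ (C : ℝ) (x : Phase), 0 < x 0 →
      (TriangularTripleCollision P C x ↔
        OrbitTendsTo P C x (EstarPlus P) ∨ OrbitTendsTo P C x (EstarMinus P))) ∧
    -- their limiting configurations are similar to no configuration of a homographic solution
    (∀ (C : ℝ) (x : Phase) (L : ℝ), L ≠ 0 → TripleCollisionWithShape P C x L →
      ∀ (C' a b : ℝ) (γ : ℝ → Phase) (ϕ : ℝ → ℝ), a < b →
        IsHomographicOn P C' γ ϕ (Set.Ioo a b) →
        ∀ t ∈ Set.Ioo a b, |γ t 1| / γ t 0 ≠ |L|) := by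
  refine ⟨hausdorffMeasure_triangularTripleCollision P,
    fun C x _ => triangularTripleCollision_iff hμB, ?_⟩
  rintro C x L hL ⟨T, γ₀, hT, -, h, hR, hz, hq⟩ C' a b γ ϕ - hγ t ht
  exact homographic_shape_ne hL hgen (shapeRho_limit hT h hL hR hz hq) hγ ht
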